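/- Let $X$ be a nonempty compact metric space and $T : X \to X$ a continuous surjective map. A continuous partition of unity $\Phi = (\varphi_i)_{1 \le i \le k}$ is a finite family of continuous functions $\varphi_i : X \to [0,1]$ with $\sum_i \varphi_i \equiv 1$. For $n \ge 1$ let $\Phi_0^{n-1}$ be the partition of unity formed by all products $\prod_{j=0}^{n-1} \varphi_{a_j} \circ T^j$, indexed by the words $(a_0,\dots,a_{n-1}) \in \{1,\dots,k\}^n$. For a $T$-invariant Borel probability measure $\mu$ put, with $0 \log 0 = 0$ and $\mu(f) = \int f \, d\mu$, $$\widetilde H_\mu(\Phi) = \sum_{\varphi \in \Phi} \bigl( -\mu(\varphi) \log \mu(\varphi) + \mu(\varphi \log \varphi) \bigr), \qquad \widetilde h_\mu(T,\Phi) = \lim_{n \to \infty} \frac1n \widetilde H_\mu(\Phi_0^{n-1}), \qquad \widetilde h_\mu(T) = \sup_\Phi \widetilde h_\mu(T,\Phi),$$ and put $$\widetilde H(\Phi) = \sum_{\varphi \in \Phi} \sup \varphi, \qquad \widetilde h(T,\Phi) = \lim_{n \to \infty} \frac1n \log \widetilde H(\Phi_0^{n-1}), \qquad \widetilde h_{\mathrm{top}}(T)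 = \sup_\Phi \widetilde h(T,\Phi),$$ the suprema being taken in $[0,\infty]$ over all continuous partitions of unity $\Phi$. Let $h_\mu(T)$ be the classical metric entropy (defined with finite measurable partitions) and $h_{\mathrm{top}}(T)$ the classical topological entropy (defined with open covers). Then the limits defining $\widetilde h_\mu(T,\Phi)$ and $\widetilde h(T,\Phi)$ exist for all continuous partitions of unity $\Phi$ and all $T$-invariant Borel probability measures $\mu$; $\widetilde h_\mu(T) = h_\mu(T)$ for every such $\mu$; and $\widetilde h_{\mathrm{top}}(T) = h_{\mathrm{top}}(T)$ (all these equalities in $[0,\infty]$). Moreover, if $(\Phi_m)_m$ is a sequence of continuous partitions of unity such that $\operatorname{diam}(\Phi_m) = \max_{\varphi \in \Phi_m} \operatorname{diam}(\operatorname{supp} \varphi)$ tends to $0$ as $m \to \infty$, then for every $T$-invariant Borel probability measure $\mu$, $$\lim_{m \to \infty} \widetilde h_\mu(T,\Phi_m) = \widetilde h_\mu(T).$$ -/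

import Mathlib

open MeasureTheory Filter Topology Set

noncomputable section

namespace EntropyPOU

/-! A finite family of functions is indexed by a finite type, so that repeated functions are counted
with multiplicity. Continuous partitions of unity are Mathlib's `PartitionOfUnity` on the whole
space, indexed by some `Fin k`. All limits and suprema of entropies are taken in `EReal`. -/

/-- The family `Φ ∨ (Φ ∘ T) ∨ ⋯ ∨ (Φ ∘ T^(n-1))`: its members are the products
`∏ j < n, φ (a j) ∘ T^j`, one for each word `a` of length `n` in the index set. -/
def iterJoin {X ι : Type*} (T : X → X) (φ : ι → X → ℝ) (n : ℕ) : (Fin n → ι) → X → ℝ :=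
  fun a x => ∏ j : Fin n, φ (a j) (T^[(j : ℕ)] x)

section Metric

variable {X : Type*} [MeasurableSpace X]

/-- Static metric entropy of a finite family of functions,
`∑ φ, (- μ(φ) log μ(φ) + μ(φ log φ))`, with `0 log 0 = 0`. -/
def staticEntropy {ι : Type*} [Fintype ι] (μ : Measure X) (φ : ι → X → ℝ) : ℝ :=
  ∑ i, (-((∫ x, φ i x ∂μ) * Real.log (∫ x, φ i x ∂μ)) + ∫ x, φ i x * Real.log (φ i x) ∂μ)

/-- Local metric entropy of a finite family of functions. -/
def localMetricEntropy {ι : Type*} [Fintype ι] (T : X → X) (μ : Measure X) (φ : ι → X → ℝ) :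
    EReal :=
  limsup (fun n : ℕ => ((staticEntropy μ (iterJoin T φ n) / n : ℝ) : EReal)) atTop

/-- Metric entropy defined with continuous partitions of unity. -/
def pouMetricEntropy [TopologicalSpace X] (T : X → X) (μ : Measure X) : EReal :=
  ⨆ (k : ℕ) (Φ : PartitionOfUnity (Fin k) X univ), localMetricEntropy T μ (fun i => ⇑(Φ i))

/-- A finite indexed partition of `X` into measurable sets (empty members are allowed). -/
structure IsMeasurablePartition {ι : Type*} (A : ι → Set X) : Prop where
  measurableSet : ∀ i, MeasurableSet (A i)
  disjoint : Pairwise (Function.onFun Disjoint A)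
  iUnion_eq : ⋃ i, A i = univ

/-- The members of the join `A ∨ T⁻¹ A ∨ ⋯ ∨ T^{-(n-1)} A`, indexed by words of length `n`. -/
def iterJoinSets {X ι : Type*} (T : X → X) (A : ι → Set X) (n : ℕ) : (Fin n → ι) → Set X :=
  fun a => ⋂ j : Fin n, T^[(j : ℕ)] ⁻¹' A (a j)

/-- Shannon entropy of a finite partition. -/
def partitionEntropy {ι : Type*} [Fintype ι] (μ : Measure X) (A : ι → Set X) : ℝ :=
  ∑ i, -(μ.real (A i) * Real.log (μ.real (A i)))

/-- Entropy of `T` with respect to a finite measurable partition. -/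
def partitionMetricEntropy {ι : Type*} [Fintype ι] (T : X → X) (μ : Measure X) (A : ι → Set X) :
    EReal :=
  limsup (fun n : ℕ => ((partitionEntropy μ (iterJoinSets T A n) / n : ℝ) : EReal)) atTop

/-- The classical (Kolmogorov–Sinai) metric entropy. -/
def metricEntropy (T : X → X) (μ : Measure X) : EReal :=
  ⨆ (k : ℕ) (A : Fin k → Set X) (_ : IsMeasurablePartition A), partitionMetricEntropy T μ A

end Metric

section Topological

variable {X : Type*}

/-- Topological static entropy of a finite family of functions, `∑ φ, sup φ`. -/
def topStaticEntropy {ι : Type*} [Fintype ι] (φ : ι → X → ℝ) : ℝ :=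
  ∑ i, ⨆ x, φ i x

/-- Local topological entropy of a finite family of functions. -/
def localTopEntropy {ι : Type*} [Fintype ι] (T : X → X) (φ : ι → X → ℝ) : EReal :=
  limsup (fun n : ℕ => ((Real.log (topStaticEntropy (iterJoin T φ n)) / n : ℝ) : EReal)) atTop

/-- Topological entropy defined with continuous partitions of unity. -/
def pouTopEntropy [TopologicalSpace X] (T : X → X) : EReal :=
  ⨆ (k : ℕ) (Φ : PartitionOfUnity (Fin k) X univ), localTopEntropy T (fun i => ⇑(Φ i))

/-- `α` is a cover of `X` by open sets. -/
structure IsOpenCover [TopologicalSpace X] (α : Set (Set X)) : Prop where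
  isOpen : ∀ U ∈ α, IsOpen U
  sUnion_eq : ⋃₀ α = univ

/-- The cover `α ∨ T⁻¹ α ∨ ⋯ ∨ T^{-(n-1)} α`. -/
def iterJoinCover (T : X → X) (α : Set (Set X)) (n : ℕ) : Set (Set X) :=
  {V | ∃ U : Fin n → Set X, (∀ j, U j ∈ α) ∧ V = ⋂ j : Fin n, T^[(j : ℕ)] ⁻¹' U j}

/-- Minimal cardinality of a finite subcover of `α`. -/
def minSubcover (α : Set (Set X)) : ℕ :=
  sInf {m | ∃ s : Finset (Set X), (s : Set (Set X)) ⊆ α ∧ ⋃₀ (s : Set (Set X)) = univ ∧ s.card = m}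

/-- Entropy of `T` with respect to an open cover. -/
def coverTopEntropy (T : X → X) (α : Set (Set X)) : EReal :=
  limsup (fun n : ℕ => ((Real.log (minSubcover (iterJoinCover T α n)) / n : ℝ) : EReal)) atTop

/-- The classical (Adler–Konheim–McAndrew) topological entropy, defined with open covers. -/
def topEntropy [TopologicalSpace X] (T : X → X) : EReal :=
  ⨆ (α : Set (Set X)) (_ : IsOpenCover α), coverTopEntropy T α

end Topological

/-- Diameter of a finite family of functions: the largest diameter of the supports. -/
def familyDiam {X ι : Type*} [MetricSpace X] (φ : ι → X → ℝ) : ℝ :=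
  ⨆ i, Metric.diam (tsupport (φ i))

end EntropyPOU

end

open MeasureTheory Filter Topology Set

noncomputable section

namespace EntropyPOU

/-! Draw a point x with law μ, then an index i with probability φ_i(x). The static entropy is the
mutual information of the index and the point: the Shannon entropy of the weights μ(φ_i) minus a
noise term, the mean of the pointwise entropy of (φ_i(x))_i. Indices of different families are
independent given x, so noise is additive under joins (`noise_join`) and Shannon's strong
subadditivity passes to static entropy. Monotonicity under joins is Jensen's inequality for
`negMulLog`. Fekete's lemma then gives the limits, and H(Φ ∨ Ψ) ≤ H(Ψ) + ε implies h(Φ) ≤ h(Ψ) + ε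
(`localMetricEntropy_le_add`).

Indicator families have no noise, so classical entropy is a special case and the two metric
entropies are compared by approximation. A partition of unity is nearly constant on the cells of a
suitable partition, where Jensen's inequality is almost an equality. Conversely, a fine enough
partition of unity almost determines the cell of a given partition, by regularity of μ and a
Fano-type bound (`shannon_le_of_concentrated`). The fineness needed depends only on μ, the partition
and ε, which also yields the statement on diameters.

For topological entropy, a cover on which the functions vary little bounds ∑ sup φ up to a factor (1
+ kη)^n. In the other direction, a maximal set of points no two of which see a common word has at
most ∑ sup φ elements and yields a subcover. -/

open Real (negMulLog)

/-! ### Shannon inequalities for nonnegative arrays. -/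

/-- Strong subadditivity of Shannon entropy. -/
theorem shannon_strong_subadditivity {ι κ τ : Type*} [Fintype ι] [Fintype κ] [Fintype τ]
    (p : ι → κ → τ → ℝ) (hp : ∀ i j k, 0 ≤ p i j k) :
    (∑ i, ∑ j, ∑ k, negMulLog (p i j k)) + ∑ j, negMulLog (∑ i, ∑ k, p i j k) ≤
      (∑ i, ∑ j, negMulLog (∑ k, p i j k)) + ∑ j, ∑ k, negMulLog (∑ i, p i j k) := by
  set q : ι → κ → ℝ := fun i j => ∑ k, p i j k with hq
  set r : κ → τ → ℝ := fun j k => ∑ i, p i j k with hr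
  set s : κ → ℝ := fun j => ∑ i, ∑ k, p i j k with hs
  have hqs : ∀ j, ∑ i, q i j = s j := fun j => rfl
  have hrs : ∀ j, ∑ k, r j k = s j := fun j => Finset.sum_comm
  have hpq : ∀ i j k, p i j k ≤ q i j := fun i j k =>
    Finset.single_le_sum (f := fun k => p i j k) (fun k _ => hp i j k) (Finset.mem_univ k)
  have hpr : ∀ i j k, p i j k ≤ r j k := fun i j k =>
    Finset.single_le_sum (f := fun i => p i j k) (fun i _ => hp i j k) (Finset.mem_univ i)
  have hq0 : ∀ i j, 0 ≤ q i j := fun i j => Finset.sum_nonneg fun k _ => hp i j k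
  have hr0 : ∀ j k, 0 ≤ r j k := fun j k => Finset.sum_nonneg fun i _ => hp i j k
  have hqs' : ∀ i j, q i j ≤ s j := fun i j =>
    Finset.single_le_sum (f := fun i => q i j) (fun i _ => hq0 i j) (Finset.mem_univ i)
  -- Apply log t ≤ t - 1 with t = qr/(sp), the ratio of the conditionally independent array to p.
  -- Both arrays have total mass ∑ s, so the right-hand sides add up to zero.
  have key : ∀ i j k, negMulLog (p i j k) - p i j k * Real.log (s j) +
      p i j k * Real.log (q i j) + p i j k * Real.log (r j k) ≤
        q i j * r j k / s j - p i j k := by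
    intro i j k
    rcases (hp i j k).eq_or_lt with h0 | h0
    · rw [← h0]
      have : 0 ≤ q i j * r j k / s j :=
        div_nonneg (mul_nonneg (hq0 i j) (hr0 j k)) ((hq0 i j).trans (hqs' i j))
      simpa using this
    · have h1 := h0.trans_le (hpq i j k)
      have h2 := h0.trans_le (hpr i j k)
      have h3 := h1.trans_le (hqs' i j)
      have hl := Real.log_le_sub_one_of_pos
        (show 0 < q i j * r j k / (s j * p i j k) by positivity)
      rw [Real.log_div (by positivity) (by positivity), Real.log_mul h1.ne' h2.ne',
        Real.log_mul h3.ne' h0.ne'] at hl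
      have := mul_le_mul_of_nonneg_left hl h0.le
      have e : p i j k * (q i j * r j k / (s j * p i j k) - 1) =
          q i j * r j k / s j - p i j k := by field_simp
      rw [e] at this
      rw [negMulLog]
      linarith
  have hsum := Finset.sum_le_sum fun j (_ : j ∈ Finset.univ) =>
    Finset.sum_le_sum fun i (_ : i ∈ Finset.univ) =>
      Finset.sum_le_sum fun k (_ : k ∈ Finset.univ) => key i j k
  have hright : ∑ j, ∑ i, ∑ k, (q i j * r j k / s j - p i j k) = 0 := by
    refine Finset.sum_eq_zero fun j _ => ?_
    have : ∑ i, ∑ k, q i j * r j k / s j = s j := by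
      simp_rw [← Finset.sum_div, ← Finset.mul_sum, ← Finset.sum_mul]
      rw [hqs, hrs]
      -- When s j = 0, the convention x / 0 = 0 gives the right value.
      rcases eq_or_ne (s j) 0 with h | h
      · simp [h]
      · field_simp
    simp only [Finset.sum_sub_distrib]
    rw [this]
    exact sub_self _
  have hterm : ∀ j, ∑ i, ∑ k, (negMulLog (p i j k) - p i j k * Real.log (s j) +
      p i j k * Real.log (q i j) + p i j k * Real.log (r j k)) =
      (∑ i, ∑ k, negMulLog (p i j k)) + negMulLog (s j) - ∑ i, negMulLog (q i j)
        - ∑ k, negMulLog (r j k) := by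
    intro j
    have a1 : ∑ i, ∑ k, p i j k * Real.log (s j) = - negMulLog (s j) := by
      simp_rw [← Finset.sum_mul]; simp [negMulLog, hs]
    have a2 : ∑ i, ∑ k, p i j k * Real.log (q i j) = - ∑ i, negMulLog (q i j) := by
      simp_rw [← Finset.sum_mul]; simp [negMulLog, hq]
    have a3 : ∑ i, ∑ k, p i j k * Real.log (r j k) = - ∑ k, negMulLog (r j k) := by
      rw [Finset.sum_comm]; simp_rw [← Finset.sum_mul]; simp [negMulLog, hr]
    simp only [Finset.sum_sub_distrib, Finset.sum_add_distrib]
    rw [a1, a2, a3]; ring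
  rw [hright] at hsum
  simp_rw [hterm] at hsum
  simp only [Finset.sum_sub_distrib, Finset.sum_add_distrib] at hsum
  rw [Finset.sum_comm (f := fun i j => ∑ k, negMulLog (p i j k)),
    Finset.sum_comm (f := fun i j => negMulLog (∑ k, p i j k))]
  linarith

/-- The tangent line at `c` lies above the graph of `negMulLog`. -/
theorem negMulLog_le_tangent {x c : ℝ} (hx : 0 ≤ x) (hc : 0 < c) :
    negMulLog x ≤ c - x - x * Real.log c := by
  rcases hx.eq_or_lt with h | h
  · simp [← h, hc.le]
  · have hl := Real.log_le_sub_one_of_pos (div_pos hc h)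
    rw [Real.log_div hc.ne' h.ne'] at hl
    have := mul_le_mul_of_nonneg_left hl h.le
    have e : x * (c / x - 1) = c - x := by field_simp
    rw [e] at this
    rw [negMulLog]
    linarith

/-! ### Static entropy of partitions of unity. -/

/-- The common refinement of two families of functions. -/
def join {X ι κ : Type*} (φ : ι → X → ℝ) (ψ : κ → X → ℝ) : ι × κ → X → ℝ :=
  fun p x => φ p.1 x * ψ p.2 x

section

variable {X : Type*} [MeasurableSpace X]

/-- A finite measurable partition of unity. -/
structure IsMeasurablePOU {ι : Type*} [Fintype ι] (φ : ι → X → ℝ) : Prop where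
  measurable : ∀ i, Measurable (φ i)
  nonneg : ∀ i x, 0 ≤ φ i x
  sum_eq : ∀ x, ∑ i, φ i x = 1

section

variable {ι κ τ : Type*} [Fintype ι] [Fintype κ] [Fintype τ]
  {φ : ι → X → ℝ} {ψ : κ → X → ℝ} {ξ : τ → X → ℝ} {μ : Measure X} {T : X → X}

theorem IsMeasurablePOU.le_one (h : IsMeasurablePOU φ) (i : ι) (x : X) : φ i x ≤ 1 := by
  rw [← h.sum_eq x]
  exact Finset.single_le_sum (f := fun i => φ i x) (fun i _ => h.nonneg i x) (Finset.mem_univ i)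

theorem IsMeasurablePOU.join (h : IsMeasurablePOU φ) (h' : IsMeasurablePOU ψ) :
    IsMeasurablePOU (join φ ψ) where
  measurable p := (h.measurable p.1).mul (h'.measurable p.2)
  nonneg _ x := mul_nonneg (h.nonneg _ x) (h'.nonneg _ x)
  sum_eq x := by
    simp only [EntropyPOU.join, Fintype.sum_prod_type, ← Finset.mul_sum, h.sum_eq, h'.sum_eq,
      mul_one]

theorem IsMeasurablePOU.comp (h : IsMeasurablePOU φ) (hT : Measurable T) :
    IsMeasurablePOU (fun i x => φ i (T x)) where
  measurable i := (h.measurable i).comp hT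
  nonneg i _ := h.nonneg i _
  sum_eq _ := h.sum_eq _

theorem IsMeasurablePOU.iterJoin (h : IsMeasurablePOU φ) (hT : Measurable T) (n : ℕ) :
    IsMeasurablePOU (iterJoin T φ n) where
  measurable a := Finset.measurable_fun_prod _ fun j _ => (h.measurable _).comp (hT.iterate _)
  nonneg _ _ := Finset.prod_nonneg fun j _ => h.nonneg _ _
  sum_eq x := by
    classical
    have := Finset.prod_univ_sum (fun _ : Fin n => (Finset.univ : Finset ι))
      (fun j i => φ i (T^[(j : ℕ)] x))
    simp only [h.sum_eq, Finset.prod_const_one, Fintype.piFinset_univ] at this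
    exact this.symm

theorem isMeasurablePOU_one : IsMeasurablePOU (fun (_ : Unit) (_ : X) => (1 : ℝ)) where
  measurable _ := measurable_const
  nonneg _ _ := zero_le_one
  sum_eq _ := by simp

theorem integrable_of_mem_unitInterval [IsFiniteMeasure μ] {f : X → ℝ} (hf : Measurable f)
    (h0 : ∀ x, 0 ≤ f x) (h1 : ∀ x, f x ≤ 1) : Integrable f μ :=
  Integrable.of_bound hf.aestronglyMeasurable 1 (ae_of_all _ fun x => by
    rw [Real.norm_of_nonneg (h0 x)]; exact h1 x)

theorem IsMeasurablePOU.integrable [IsFiniteMeasure μ] (h : IsMeasurablePOU φ) (i : ι) :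
    Integrable (φ i) μ :=
  integrable_of_mem_unitInterval (h.measurable i) (h.nonneg i) (h.le_one i)

theorem negMulLog_le_one {x : ℝ} (h0 : 0 ≤ x) : negMulLog x ≤ 1 := by
  have := negMulLog_le_tangent h0 one_pos
  rw [Real.log_one] at this
  linarith

theorem IsMeasurablePOU.integrable_negMulLog [IsFiniteMeasure μ] (h : IsMeasurablePOU φ) (i : ι) :
    Integrable (fun x => negMulLog (φ i x)) μ :=
  integrable_of_mem_unitInterval (Real.continuous_negMulLog.measurable.comp (h.measurable i))
    (fun x => Real.negMulLog_nonneg (h.nonneg i x) (h.le_one i x))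
    (fun x => negMulLog_le_one (h.nonneg i x))

theorem IsMeasurablePOU.integrable_mul_negMulLog [IsFiniteMeasure μ] (h : IsMeasurablePOU φ)
    (h' : IsMeasurablePOU ψ) (i : ι) (j : κ) :
    Integrable (fun x => φ i x * negMulLog (ψ j x)) μ :=
  integrable_of_mem_unitInterval
    ((h.measurable i).mul (Real.continuous_negMulLog.measurable.comp (h'.measurable j)))
    (fun x => mul_nonneg (h.nonneg i x) (Real.negMulLog_nonneg (h'.nonneg j x) (h'.le_one j x)))
    (fun x => mul_le_one₀ (h.le_one i x) (Real.negMulLog_nonneg (h'.nonneg j x) (h'.le_one j x))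
      (negMulLog_le_one (h'.nonneg j x)))

theorem IsMeasurablePOU.sum_integral [IsProbabilityMeasure μ] (h : IsMeasurablePOU φ) :
    ∑ i, ∫ x, φ i x ∂μ = 1 := by
  rw [← integral_finsetSum _ fun i _ => h.integrable i]
  simp [h.sum_eq]

theorem sum_integral_mul_right [IsProbabilityMeasure μ] (h : IsMeasurablePOU φ)
    (h' : IsMeasurablePOU ψ) (i : ι) : ∑ j, ∫ x, φ i x * ψ j x ∂μ = ∫ x, φ i x ∂μ := by
  have hint : ∀ j, Integrable (fun x => φ i x * ψ j x) μ := fun j =>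
    (h.join h').integrable (i, j)
  rw [← integral_finsetSum _ fun j _ => hint j]
  simp_rw [← Finset.mul_sum, h'.sum_eq, mul_one]

theorem sum_integral_mul_left [IsProbabilityMeasure μ] (h : IsMeasurablePOU φ)
    (h' : IsMeasurablePOU ψ) (j : κ) : ∑ i, ∫ x, φ i x * ψ j x ∂μ = ∫ x, ψ j x ∂μ := by
  simpa only [mul_comm] using sum_integral_mul_right (μ := μ) h' h j

/-- The part of the static entropy coming from the functions not being indicators. -/
def noise (μ : Measure X) (φ : ι → X → ℝ) : ℝ := ∑ i, ∫ x, negMulLog (φ i x) ∂μ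

theorem staticEntropy_eq (μ : Measure X) (φ : ι → X → ℝ) :
    staticEntropy μ φ = (∑ i, negMulLog (∫ x, φ i x ∂μ)) - noise μ φ := by
  simp only [staticEntropy, noise, negMulLog, ← Finset.sum_sub_distrib]
  refine Finset.sum_congr rfl fun i _ => ?_
  simp_rw [neg_mul]
  rw [integral_neg, sub_neg_eq_add]

theorem staticEntropy_equiv (e : κ ≃ ι) (μ : Measure X) (φ : ι → X → ℝ) :
    staticEntropy μ (fun i => φ (e i)) = staticEntropy μ φ :=
  e.sum_comp fun i =>
    (-((∫ x, φ i x ∂μ) * Real.log (∫ x, φ i x ∂μ)) + ∫ x, φ i x * Real.log (φ i x) ∂μ)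

theorem noise_eq_integral [IsFiniteMeasure μ] (h : IsMeasurablePOU φ) :
    noise μ φ = ∫ x, ∑ i, negMulLog (φ i x) ∂μ :=
  (integral_finsetSum _ fun i _ => h.integrable_negMulLog i).symm

/-- At each point the weights of the join form a product distribution, and the entropy of a product
is the sum of the entropies. -/
theorem noise_join [IsFiniteMeasure μ] (h : IsMeasurablePOU φ) (h' : IsMeasurablePOU ψ) :
    noise μ (join φ ψ) = noise μ φ + noise μ ψ := by
  rw [noise_eq_integral h, noise_eq_integral h', noise_eq_integral (h.join h'),
    ← integral_add (integrable_finsetSum _ fun i _ => h.integrable_negMulLog i)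
      (integrable_finsetSum _ fun i _ => h'.integrable_negMulLog i)]
  congr 1 with x
  simp only [join, Fintype.sum_prod_type, Real.negMulLog_mul, Finset.sum_add_distrib,
    ← Finset.mul_sum, ← Finset.sum_mul, h.sum_eq, h'.sum_eq, one_mul]

theorem staticEntropy_join_eq [IsFiniteMeasure μ] (h : IsMeasurablePOU φ)
    (h' : IsMeasurablePOU ψ) :
    staticEntropy μ (join φ ψ) =
      (∑ i, ∑ j, negMulLog (∫ x, φ i x * ψ j x ∂μ)) - noise μ φ - noise μ ψ := by
  rw [staticEntropy_eq, noise_join h h', Fintype.sum_prod_type]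
  simp only [join]
  ring

theorem staticEntropy_join_comm (μ : Measure X) (φ : ι → X → ℝ) (ψ : κ → X → ℝ) :
    staticEntropy μ (join φ ψ) = staticEntropy μ (join ψ φ) := by
  rw [← staticEntropy_equiv (Equiv.prodComm ι κ) μ (join ψ φ)]
  congr 1
  ext p x
  simp [join, mul_comm]

/-- Each side contains the noise of φ once, of ψ twice and of ξ once, so the noise cancels and the
Shannon inequality remains. -/
theorem staticEntropy_strong_subadditivity [IsProbabilityMeasure μ] (h : IsMeasurablePOU φ)
    (h' : IsMeasurablePOU ψ) (h'' : IsMeasurablePOU ξ) :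
    staticEntropy μ (join φ (join ψ ξ)) + staticEntropy μ ψ ≤
      staticEntropy μ (join φ ψ) + staticEntropy μ (join ψ ξ) := by
  have key := shannon_strong_subadditivity (fun i j k => ∫ x, φ i x * (ψ j x * ξ k x) ∂μ)
    (fun i j k => integral_nonneg fun x =>
      (h.join (h'.join h'')).nonneg (i, (j, k)) x)
  have e1 : ∀ i j, ∑ k, ∫ x, φ i x * (ψ j x * ξ k x) ∂μ = ∫ x, φ i x * ψ j x ∂μ := by
    intro i j
    simp_rw [← mul_assoc]
    exact sum_integral_mul_right (h.join h') h'' (i, j)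
  have e2 : ∀ j k, ∑ i, ∫ x, φ i x * (ψ j x * ξ k x) ∂μ = ∫ x, ψ j x * ξ k x ∂μ := fun j k =>
    sum_integral_mul_left h (h'.join h'') (j, k)
  have e3 : ∀ j, ∑ i, ∫ x, φ i x * ψ j x ∂μ = ∫ x, ψ j x ∂μ := fun j =>
    sum_integral_mul_left h h' j
  simp_rw [e1, e2, e3] at key
  rw [staticEntropy_join_eq h (h'.join h''), staticEntropy_join_eq h h',
    staticEntropy_join_eq h' h'', noise_join h' h'', staticEntropy_eq μ ψ]
  simp only [Fintype.sum_prod_type, join]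
  linarith

/-- Jensen's inequality for ψ_j under the weight φ_i μ: the conditional Shannon entropy of ψ given φ
is at least the noise of ψ. -/
theorem staticEntropy_le_join [IsProbabilityMeasure μ] (h : IsMeasurablePOU φ)
    (h' : IsMeasurablePOU ψ) : staticEntropy μ φ ≤ staticEntropy μ (join φ ψ) := by
  have key : ∀ i j, ∫ x, φ i x * negMulLog (ψ j x) ∂μ ≤ negMulLog (∫ x, φ i x * ψ j x ∂μ) +
      (∫ x, φ i x * ψ j x ∂μ) * Real.log (∫ x, φ i x ∂μ) := by
    intro i j
    have hint : Integrable (fun x => φ i x * ψ j x) μ := (h.join h').integrable (i, j)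
    have h0 : ∀ x, 0 ≤ φ i x * ψ j x := (h.join h').nonneg (i, j)
    have hle : ∫ x, φ i x * ψ j x ∂μ ≤ ∫ x, φ i x ∂μ :=
      integral_mono hint (h.integrable i) fun x =>
        mul_le_of_le_one_right (h.nonneg i x) (h'.le_one j x)
    rcases (integral_nonneg (μ := μ) (f := fun x => φ i x * ψ j x) h0).eq_or_lt with hz | hz
    · have hae := (integral_eq_zero_iff_of_nonneg h0 hint).1 hz.symm
      have : ∫ x, φ i x * negMulLog (ψ j x) ∂μ = 0 := by
        refine integral_eq_zero_of_ae ?_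
        filter_upwards [hae] with x hx
        rcases mul_eq_zero.1 hx with hx | hx <;> simp [hx]
      rw [this, ← hz]
      simp
    · have hpi := hz.trans_le hle
      set p := ∫ x, φ i x * ψ j x ∂μ with hp
      set q := ∫ x, φ i x ∂μ with hq
      -- p / q is the φ_i-weighted mean of ψ_j. Integrating the tangent at this point proves
      -- Jensen's inequality.
      have hc : 0 < p / q := div_pos hz hpi
      calc ∫ x, φ i x * negMulLog (ψ j x) ∂μ
          ≤ ∫ x, (p / q) * φ i x - (1 + Real.log (p / q)) * (φ i x * ψ j x) ∂μ := by
            refine integral_mono (h.integrable_mul_negMulLog h' i j)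
              (((h.integrable i).const_mul _).sub (hint.const_mul _)) fun x => ?_
            have := mul_le_mul_of_nonneg_left
              (negMulLog_le_tangent (h'.nonneg j x) hc) (h.nonneg i x)
            simp only
            linarith
        _ = p / q * q - (1 + Real.log (p / q)) * p := by
            rw [integral_sub ((h.integrable i).const_mul _) (hint.const_mul _),
              integral_const_mul, integral_const_mul]
        _ = negMulLog p + p * Real.log q := by
            rw [Real.log_div hz.ne' hpi.ne', negMulLog]
            field_simp
            ring
  have hsum := Finset.sum_le_sum fun i (_ : i ∈ Finset.univ) =>
    Finset.sum_le_sum fun j (_ : j ∈ Finset.univ) => key i j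
  have e1 : ∑ i, ∑ j, ∫ x, φ i x * negMulLog (ψ j x) ∂μ = noise μ ψ := by
    rw [Finset.sum_comm]
    refine Finset.sum_congr rfl fun j _ => ?_
    rw [← integral_finsetSum _ fun i _ => h.integrable_mul_negMulLog h' i j]
    simp_rw [← Finset.sum_mul, h.sum_eq, one_mul]
  have e2 : ∑ i, ∑ j, (∫ x, φ i x * ψ j x ∂μ) * Real.log (∫ x, φ i x ∂μ) =
      - ∑ i, negMulLog (∫ x, φ i x ∂μ) := by
    simp_rw [← Finset.sum_mul, sum_integral_mul_right h h']
    simp [negMulLog]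
  simp only [Finset.sum_add_distrib] at hsum
  rw [e1, e2] at hsum
  rw [staticEntropy_join_eq h h', staticEntropy_eq]
  linarith

theorem staticEntropy_join_le [IsProbabilityMeasure μ] (h : IsMeasurablePOU φ)
    (h' : IsMeasurablePOU ψ) :
    staticEntropy μ (join φ ψ) ≤ staticEntropy μ φ + staticEntropy μ ψ := by
  -- Conditioning on the trivial family turns strong subadditivity into plain subadditivity.
  have key := staticEntropy_strong_subadditivity (μ := μ) h isMeasurablePOU_one h'
  have e0 : staticEntropy μ (fun (_ : Unit) (_ : X) => (1 : ℝ)) = 0 := by simp [staticEntropy]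
  have e1 : staticEntropy μ (join φ (fun (_ : Unit) (_ : X) => (1 : ℝ))) = staticEntropy μ φ := by
    rw [← staticEntropy_equiv (Equiv.prodPUnit ι) μ φ]
    congr 1
    ext p x
    simp [join]
  have e2 : staticEntropy μ (join (fun (_ : Unit) (_ : X) => (1 : ℝ)) ψ) = staticEntropy μ ψ := by
    rw [← staticEntropy_equiv (Equiv.punitProd κ) μ ψ]
    congr 1
    ext p x
    simp [join]
  have e3 : staticEntropy μ (join φ (join (fun (_ : Unit) (_ : X) => (1 : ℝ)) ψ)) =
      staticEntropy μ (join φ ψ) := by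
    rw [← staticEntropy_equiv ((Equiv.refl ι).prodCongr (Equiv.punitProd κ)) μ (join φ ψ)]
    congr 1
    ext p x
    simp [join]
  rw [e0, e1, e2, e3] at key
  linarith

theorem staticEntropy_nonneg [IsProbabilityMeasure μ] (h : IsMeasurablePOU φ) :
    0 ≤ staticEntropy μ φ := by
  have h1 := staticEntropy_le_join (μ := μ) isMeasurablePOU_one h
  have h2 := staticEntropy_join_le (μ := μ) isMeasurablePOU_one h
  have e0 : staticEntropy μ (fun (_ : Unit) (_ : X) => (1 : ℝ)) = 0 := by simp [staticEntropy]
  linarith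

end

end

/-! ### Words and indicator families. -/

section Words

variable {X ι : Type*}

theorem iterJoin_append (T : X → X) (φ : ι → X → ℝ) (m n : ℕ) :
    (fun a => iterJoin T φ (m + n) (Fin.appendEquiv m n a)) =
      join (iterJoin T φ m) (fun b x => iterJoin T φ n b (T^[m] x)) := by
  ext a x
  simp only [iterJoin, join, Fin.prod_univ_add, Fin.appendEquiv, Equiv.coe_fn_mk,
    Fin.append_left, Fin.append_right, Fin.val_castAdd, Fin.val_natAdd]
  congr 1
  refine Finset.prod_congr rfl fun j _ => ?_
  rw [← Function.iterate_add_apply, add_comm]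

/-- The letter at the latest time comes first in the join, the position in which strong
subadditivity bounds its contribution. -/
theorem iterJoin_snoc (T : X → X) (φ : ι → X → ℝ) (n : ℕ) :
    (fun a => iterJoin T φ (n + 1) (Fin.snocEquiv (fun _ => ι) a)) =
      join (fun i x => φ i (T^[n] x)) (iterJoin T φ n) := by
  ext a x
  simp [iterJoin, join, Fin.prod_univ_castSucc, Fin.snocEquiv, mul_comm]

/-- The partition of unity formed by the indicator functions of a family of sets. -/
def indicatorFamily (A : ι → Set X) : ι → X → ℝ := fun i => (A i).indicator 1

theorem negMulLog_indicatorFamily (A : ι → Set X) (i : ι) (x : X) :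
    negMulLog (indicatorFamily A i x) = 0 := by
  by_cases hx : x ∈ A i <;> simp [indicatorFamily, hx]

theorem integral_indicatorFamily [MeasurableSpace X] {μ : Measure X} {A : ι → Set X} (i : ι)
    (hA : MeasurableSet (A i)) :
    ∫ x, indicatorFamily A i x ∂μ = μ.real (A i) :=
  integral_indicator_one hA

theorem iterJoin_indicatorFamily (T : X → X) (A : ι → Set X) (n : ℕ) :
    iterJoin T (indicatorFamily A) n = indicatorFamily (iterJoinSets T A n) := by
  ext a x
  simp only [iterJoin, indicatorFamily, iterJoinSets]
  by_cases hx : x ∈ ⋂ j : Fin n, T^[(j : ℕ)] ⁻¹' A (a j)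
  · rw [Set.indicator_of_mem hx]
    exact Finset.prod_eq_one fun j _ => Set.indicator_of_mem (s := A (a j)) (mem_iInter.1 hx j) 1
  · rw [Set.indicator_of_notMem hx]
    obtain ⟨j, hj⟩ := not_forall.1 (fun h => hx (mem_iInter.2 h))
    exact Finset.prod_eq_zero (Finset.mem_univ j) (Set.indicator_of_notMem (s := A (a j)) hj 1)

end Words

/-! ### Local metric entropy and its dependence on the family. -/

section

variable {X : Type*} [MeasurableSpace X] {ι κ : Type*} [Fintype ι] [Fintype κ]
  {φ : ι → X → ℝ} {ψ : κ → X → ℝ} {μ : Measure X} {T : X → X}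

theorem staticEntropy_comp (hT : MeasurePreserving T μ μ) (h : IsMeasurablePOU φ) :
    staticEntropy μ (fun i x => φ i (T x)) = staticEntropy μ φ := by
  have key : ∀ f : X → ℝ, Measurable f → ∫ x, f (T x) ∂μ = ∫ x, f x ∂μ := fun f hf => by
    have := integral_map (μ := μ) hT.measurable.aemeasurable (f := f) hf.aestronglyMeasurable
    rw [hT.map_eq] at this
    exact this.symm
  simp only [staticEntropy_eq, noise]
  congr 1
  · exact Finset.sum_congr rfl fun i _ => by rw [key _ (h.measurable i)]
  · exact Finset.sum_congr rfl fun i _ =>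
      key (fun x => negMulLog (φ i x)) (Real.continuous_negMulLog.measurable.comp (h.measurable i))

theorem staticEntropy_iterJoin_subadditive [IsProbabilityMeasure μ]
    (hT : MeasurePreserving T μ μ) (h : IsMeasurablePOU φ) :
    Subadditive fun n => staticEntropy μ (iterJoin T φ n) := by
  intro m n
  have hn := h.iterJoin hT.measurable n
  simp only
  rw [← staticEntropy_equiv (Fin.appendEquiv m n), iterJoin_append,
    ← staticEntropy_comp (hT.iterate m) hn]
  exact staticEntropy_join_le (h.iterJoin hT.measurable m) (hn.comp (hT.measurable.iterate m))

theorem limsup_eq_of_tendsto_coe {u : ℕ → ℝ} {a : ℝ} (h : Tendsto u atTop (𝓝 a)) :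
    limsup (fun n => (u n : EReal)) atTop = a :=
  ((continuous_coe_real_ereal.tendsto a).comp h).limsup_eq

theorem exists_tendsto_staticEntropy [IsProbabilityMeasure μ]
    (hT : MeasurePreserving T μ μ) (h : IsMeasurablePOU φ) :
    ∃ a : ℝ, Tendsto (fun n : ℕ => staticEntropy μ (iterJoin T φ n) / n) atTop (𝓝 a) ∧
      localMetricEntropy T μ φ = a := by
  have ht := (staticEntropy_iterJoin_subadditive hT h).tendsto_lim
    ⟨0, by
      rintro _ ⟨n, rfl⟩
      exact div_nonneg (staticEntropy_nonneg (h.iterJoin hT.measurable n)) n.cast_nonneg⟩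
  exact ⟨_, ht, limsup_eq_of_tendsto_coe ht⟩

/-- In terms of conditional entropy, H(φⁿ | ψⁿ) ≤ n H(φ | ψ): each new letter of φ costs at most its
entropy given the letter of ψ at the same time. -/
theorem staticEntropy_iterJoin_join_le [IsProbabilityMeasure μ]
    (hT : MeasurePreserving T μ μ) (h : IsMeasurablePOU φ) (h' : IsMeasurablePOU ψ) (n : ℕ) :
    staticEntropy μ (join (iterJoin T φ n) (iterJoin T ψ n)) ≤
      staticEntropy μ (iterJoin T ψ n) +
        n * (staticEntropy μ (join φ ψ) - staticEntropy μ ψ) := by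
  induction n with
  | zero =>
    have h0 : ∀ p, join (iterJoin T φ 0) (iterJoin T ψ 0) p = fun _ => 1 := fun p => by
      ext x; simp [join, iterJoin]
    have h1 : ∀ p, iterJoin T ψ 0 p = fun _ => 1 := fun p => by
      ext x; simp [iterJoin]
    simp [staticEntropy, h0, h1]
  | succ n ih =>
    have hTn := hT.measurable.iterate n
    have hφ := h.comp hTn
    have hψ := h'.comp hTn
    have hφn := h.iterJoin hT.measurable n
    have hψn := h'.iterJoin hT.measurable n
    set φ₁ := fun i x => φ i (T^[n] x)
    set ψ₁ := fun i x => ψ i (T^[n] x)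
    have e1 : staticEntropy μ (iterJoin T ψ (n + 1)) =
        staticEntropy μ (join ψ₁ (iterJoin T ψ n)) := by
      rw [← staticEntropy_equiv (Fin.snocEquiv (fun _ => κ)), iterJoin_snoc]
    have e2 : staticEntropy μ (join (iterJoin T φ (n + 1)) (iterJoin T ψ (n + 1))) =
        staticEntropy μ (join φ₁ (join ψ₁ (join (iterJoin T φ n) (iterJoin T ψ n)))) := by
      rw [← staticEntropy_equiv ((Equiv.prodProdProdComm ι κ _ _).trans
          ((Fin.snocEquiv (fun _ => ι)).prodCongr (Fin.snocEquiv (fun _ => κ)))),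
        ← staticEntropy_equiv (Equiv.prodAssoc ι κ _) μ
        (join φ₁ (join ψ₁ (join (iterJoin T φ n) (iterJoin T ψ n))))]
      congr 1
      ext p x
      have i1 := congrFun (congrFun (iterJoin_snoc T φ n) (p.1.1, p.2.1)) x
      have i2 := congrFun (congrFun (iterJoin_snoc T ψ n) (p.1.2, p.2.2)) x
      simp only [join] at i1 i2
      simp only [join, Equiv.trans_apply, Equiv.prodCongr_apply, Prod.map_fst, Prod.map_snd,
        Equiv.prodProdProdComm_apply, Equiv.prodAssoc_apply, i1, i2, φ₁, ψ₁]
      ring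
    have e3 : staticEntropy μ (join ψ₁ (join (iterJoin T φ n) (iterJoin T ψ n))) =
        staticEntropy μ (join (iterJoin T φ n) (join (iterJoin T ψ n) ψ₁)) := by
      rw [staticEntropy_join_comm, ← staticEntropy_equiv (Equiv.prodAssoc _ _ _) μ
        (join (iterJoin T φ n) (join (iterJoin T ψ n) ψ₁))]
      congr 1
      ext p x
      simp [join, mul_assoc]
    -- `s1` forgets the past when bounding the new letter of φ given that of ψ; `s2` says that
    -- knowing the new letter of ψ does not raise the entropy of the past of φ given the past of ψ.
    have s1 := staticEntropy_strong_subadditivity (μ := μ) hφ hψ (hφn.join hψn)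
    have s2 := staticEntropy_strong_subadditivity (μ := μ) hφn hψn hψ
    have s3 : staticEntropy μ (join φ₁ ψ₁) = staticEntropy μ (join φ ψ) :=
      staticEntropy_comp (hT.iterate n) (h.join h')
    have s4 : staticEntropy μ ψ₁ = staticEntropy μ ψ := staticEntropy_comp (hT.iterate n) h'
    rw [e3] at s1
    rw [e1, e2, staticEntropy_join_comm μ ψ₁ (iterJoin T ψ n)]
    push_cast
    rw [← s3, ← s4] at ih ⊢
    linarith

/-- Changing the partition of unity changes the local entropy by at most the conditional static
entropy. -/
theorem localMetricEntropy_le_add [IsProbabilityMeasure μ] (hT : MeasurePreserving T μ μ)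
    (h : IsMeasurablePOU φ) (h' : IsMeasurablePOU ψ) {ε : ℝ}
    (hε : staticEntropy μ (join φ ψ) ≤ staticEntropy μ ψ + ε) :
    localMetricEntropy T μ φ ≤ localMetricEntropy T μ ψ + (ε : EReal) := by
  obtain ⟨a, ha, ha'⟩ := exists_tendsto_staticEntropy hT h
  obtain ⟨b, hb, hb'⟩ := exists_tendsto_staticEntropy hT h'
  rw [ha', hb', ← EReal.coe_add, EReal.coe_le_coe_iff]
  refine le_of_tendsto_of_tendsto ha (hb.add_const ε) ?_
  filter_upwards [eventually_gt_atTop 0] with n hn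
  have hn' : (0 : ℝ) < n := Nat.cast_pos.2 hn
  have h1 := staticEntropy_le_join (μ := μ) (h.iterJoin hT.measurable n)
    (h'.iterJoin hT.measurable n)
  have h2 := staticEntropy_iterJoin_join_le hT h h' n
  have h3 := mul_le_mul_of_nonneg_left hε hn'.le
  rw [div_add' _ _ _ hn'.ne']
  gcongr
  linarith

theorem noise_indicatorFamily (A : ι → Set X) : noise μ (indicatorFamily A) = 0 := by
  simp [noise, negMulLog_indicatorFamily]

theorem IsMeasurablePartition.isMeasurablePOU {A : ι → Set X} (hA : IsMeasurablePartition A) :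
    IsMeasurablePOU (indicatorFamily A) where
  measurable i := measurable_one.indicator (hA.measurableSet i)
  nonneg i := Set.indicator_nonneg fun _ _ => zero_le_one
  sum_eq x := by
    obtain ⟨i, hi⟩ := mem_iUnion.1 (hA.iUnion_eq.ge (mem_univ x))
    rw [Finset.sum_eq_single i]
    · simp [indicatorFamily, hi]
    · intro j _ hj
      exact Set.indicator_of_notMem (fun hx => (disjoint_left.1 (hA.disjoint hj)) hx hi) _
    · simp

theorem partitionMetricEntropy_eq {A : ι → Set X} (hT : Measurable T)
    (hA : IsMeasurablePartition A) :
    partitionMetricEntropy T μ A = localMetricEntropy T μ (indicatorFamily A) := by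
  have key : ∀ n, partitionEntropy μ (iterJoinSets T A n) =
      staticEntropy μ (iterJoin T (indicatorFamily A) n) := by
    intro n
    rw [iterJoin_indicatorFamily, staticEntropy_eq, noise_indicatorFamily, sub_zero]
    refine Finset.sum_congr rfl fun a _ => ?_
    rw [integral_indicatorFamily a (MeasurableSet.iInter fun j =>
      (hT.iterate _) (hA.measurableSet _)), negMulLog, neg_mul]
  simp only [partitionMetricEntropy, localMetricEntropy, key]

end

/-! ### Conditional entropy between partitions and partitions of unity. -/

theorem negMulLog_add_mul_log_le {p q c : ℝ} (hp : 0 ≤ p) (hpq : p ≤ q) (hc : 0 < c) :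
    negMulLog p + p * Real.log q ≤ c * q - p - p * Real.log c := by
  rcases hp.eq_or_lt with h | h
  · rw [← h] at hpq ⊢
    simpa using mul_nonneg hc.le hpq
  · have hq := h.trans_le hpq
    -- The left-hand side is q · `negMulLog (p / q)`, so this is the tangent bound at c for the
    -- conditional probability, scaled by q.
    have h1 := mul_le_mul_of_nonneg_left (negMulLog_le_tangent (div_nonneg hp hq.le) hc) hq.le
    have h2 : q * (c - p / q - p / q * Real.log c) = c * q - p - p * Real.log c := by field_simp
    have h3 : q * negMulLog (p / q) = negMulLog p + p * Real.log q := by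
      rw [negMulLog, negMulLog, Real.log_div h.ne' hq.ne']
      field_simp
      ring
    linarith

/-- If `f` guesses the first coordinate from the second one with a small probability of error,
then the conditional entropy of the first coordinate given the second one is small. -/
theorem shannon_le_of_concentrated {ι κ : Type*} [Fintype ι] [Fintype κ] [DecidableEq κ]
    (p : κ → ι → ℝ) (hp : ∀ a i, 0 ≤ p a i) (hsum : ∑ i, ∑ a, p a i = 1) (f : ι → κ)
    {c e : ℝ} (hc : 0 < c) (hc1 : c ≤ 1)
    (he : ∑ i, ∑ a ∈ Finset.univ.erase (f i), p a i ≤ e) :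
    ∑ a, ∑ i, negMulLog (p a i) ≤
      (∑ i, negMulLog (∑ a, p a i)) + (Fintype.card κ * c + (1 - Real.log c) * e) := by
  have hlog : Real.log c ≤ 0 := Real.log_nonpos hc.le hc1
  have hle : ∀ a i, p a i ≤ ∑ a, p a i := fun a i =>
    Finset.single_le_sum (f := fun a => p a i) (fun a _ => hp a i) (Finset.mem_univ a)
  have key : ∀ i, (∑ a, negMulLog (p a i)) - negMulLog (∑ a, p a i) ≤
      Fintype.card κ * c * (∑ a, p a i) +
        (1 - Real.log c) * ∑ a ∈ Finset.univ.erase (f i), p a i := by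
    intro i
    set q := ∑ a, p a i with hq
    set r := ∑ a ∈ Finset.univ.erase (f i), p a i with hr
    have hq0 : 0 ≤ q := Finset.sum_nonneg fun a _ => hp a i
    have hqr : p (f i) i + r = q :=
      Finset.add_sum_erase _ (fun a => p a i) (Finset.mem_univ (f i))
    have e1 : (∑ a, negMulLog (p a i)) - negMulLog q =
        ∑ a, (negMulLog (p a i) + p a i * Real.log q) := by
      rw [Finset.sum_add_distrib, ← Finset.sum_mul, ← hq, negMulLog]; ring
    -- The tangent at 1 suits the guessed value, whose conditional probability should be near 1, and
    -- costs only the error r. The tangent at the small c is used for all other values.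
    have h1 := negMulLog_add_mul_log_le (hp (f i) i) (hle _ i) one_pos
    rw [Real.log_one] at h1
    have h2 : ∑ a ∈ Finset.univ.erase (f i), (negMulLog (p a i) + p a i * Real.log q) ≤
        ∑ a ∈ Finset.univ.erase (f i), (c * q - p a i * Real.log c) :=
      Finset.sum_le_sum fun a _ => by
        have := negMulLog_add_mul_log_le (hp a i) (hle a i) hc
        linarith [hp a i]
    have h3 : ∑ a ∈ Finset.univ.erase (f i), (c * q - p a i * Real.log c) ≤
        Fintype.card κ * c * q - r * Real.log c := by
      rw [Finset.sum_sub_distrib, Finset.sum_const, nsmul_eq_mul, hr, Finset.sum_mul]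
      have : ((Finset.univ.erase (f i)).card : ℝ) ≤ Fintype.card κ := by
        exact_mod_cast Finset.card_le_univ _
      have := mul_le_mul_of_nonneg_right this (mul_nonneg hc.le hq0)
      linarith
    rw [e1, ← Finset.add_sum_erase _ _ (Finset.mem_univ (f i))]
    linarith
  have := Finset.sum_le_sum fun i (_ : i ∈ Finset.univ) => key i
  rw [Finset.sum_sub_distrib, Finset.sum_add_distrib, ← Finset.mul_sum, ← Finset.mul_sum, hsum]
    at this
  have h4 := mul_le_mul_of_nonneg_left he (show 0 ≤ 1 - Real.log c by linarith)
  rw [Finset.sum_comm]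
  linarith

section

variable {X : Type*} [MeasurableSpace X] {ι κ : Type*} [Fintype ι] [Fintype κ]
  {φ : ι → X → ℝ} {μ : Measure X} {A : κ → Set X}

/-- There is a finite measurable partition on whose members the functions vary little. -/
theorem IsMeasurablePOU.exists_partition (h : IsMeasurablePOU φ) {δ : ℝ} (hδ : 0 < δ) :
    ∃ (k : ℕ) (A : Fin k → Set X), IsMeasurablePartition A ∧
      ∀ a, ∀ x ∈ A a, ∀ y ∈ A a, ∀ i, φ i x ≤ φ i y + δ := by
  -- The cells are the joint level sets of ⌊N φ_i⌋. There are N + 1 levels because φ_i may equal 1.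
  obtain ⟨N, hN⟩ := exists_nat_gt δ⁻¹
  have hN0 : (0 : ℝ) < N := (inv_pos.2 hδ).trans hN
  have hlt : ∀ i x, ⌊N * φ i x⌋₊ < N + 1 := fun i x =>
    (Nat.floor_lt' N.succ_ne_zero).2 (by
      push_cast
      nlinarith [h.le_one i x])
  have hmeas : ∀ i (m : ℕ), MeasurableSet {x | ⌊N * φ i x⌋₊ = m} := fun i m =>
    (Nat.measurable_floor.comp ((h.measurable i).const_mul (N : ℝ))) (measurableSet_singleton m)
  classical
  let e := (Fintype.equivFin (ι → Fin (N + 1))).symm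
  refine ⟨_, fun a => {x | ∀ i, ⌊N * φ i x⌋₊ = e a i}, ⟨fun a => ?_, fun a b hab => ?_, ?_⟩, ?_⟩
  · rw [ofPred_forall]
    exact MeasurableSet.iInter fun i => hmeas i _
  · refine disjoint_left.2 fun x hx hy => hab (e.injective ?_)
    ext i
    exact (hx i).symm.trans (hy i)
  · refine eq_univ_of_forall fun x => mem_iUnion.2 ⟨e.symm fun i => ⟨_, hlt i x⟩, fun i => ?_⟩
    simp
  · intro a x hx y hy i
    have h1 := Nat.lt_floor_add_one ((N : ℝ) * φ i x)
    have h2 := Nat.floor_le (mul_nonneg hN0.le (h.nonneg i y))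
    rw [hx i, ← hy i] at h1
    have h3 : 1 ≤ N * δ := by
      have := mul_le_mul_of_nonneg_right hN.le hδ.le
      rwa [inv_mul_cancel₀ hδ.ne'] at this
    have h4 : (N : ℝ) * φ i x ≤ N * (φ i y + δ) := by linarith
    exact le_of_mul_le_mul_left h4 hN0

/-- On a cell of positive measure the mean p / m of φ_i is within δ of all its values, so
`negMulLog` of the mean exceeds the mean of `negMulLog` by at most ε. Summation leaves exactly the
noise of φ, which static entropy subtracts. -/
theorem staticEntropy_join_indicator_le [IsProbabilityMeasure μ] (h : IsMeasurablePOU φ)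
    (hA : IsMeasurablePartition A) {δ ε : ℝ}
    (hosc : ∀ a, ∀ x ∈ A a, ∀ y ∈ A a, ∀ i, φ i x ≤ φ i y + δ)
    (hδ : ∀ s ∈ Icc (0 : ℝ) 1, ∀ t ∈ Icc (0 : ℝ) 1, |s - t| ≤ δ →
      negMulLog s ≤ negMulLog t + ε) :
    staticEntropy μ (join φ (indicatorFamily A)) ≤
      staticEntropy μ (indicatorFamily A) + Fintype.card ι * ε := by
  have hP := hA.isMeasurablePOU
  have key : ∀ i a, negMulLog (∫ x, φ i x * indicatorFamily A a x ∂μ) ≤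
      (∫ x, indicatorFamily A a x * negMulLog (φ i x) ∂μ) +
        ε * (∫ x, indicatorFamily A a x ∂μ) -
        (∫ x, φ i x * indicatorFamily A a x ∂μ) * Real.log (∫ x, indicatorFamily A a x ∂μ) := by
    intro i a
    have hig := hP.integrable (μ := μ) a
    have hip : Integrable (fun x => φ i x * indicatorFamily A a x) μ :=
      (h.join hP).integrable (i, a)
    have hin := hP.integrable_mul_negMulLog (μ := μ) h a i
    have hp0 : 0 ≤ ∫ x, φ i x * indicatorFamily A a x ∂μ :=
      integral_nonneg ((h.join hP).nonneg (i, a))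
    have hpm : ∫ x, φ i x * indicatorFamily A a x ∂μ ≤ ∫ x, indicatorFamily A a x ∂μ :=
      integral_mono hip hig fun x => mul_le_of_le_one_left (hP.nonneg a x) (h.le_one i x)
    set p := ∫ x, φ i x * indicatorFamily A a x ∂μ with hp
    set m := ∫ x, indicatorFamily A a x ∂μ with hm
    rcases (hp0.trans hpm).eq_or_lt with hm0 | hm0
    · have hpz : p = 0 := le_antisymm (hm0 ▸ hpm) hp0
      rw [hpz, ← hm0]
      simpa using integral_nonneg (μ := μ)
        (f := fun x => indicatorFamily A a x * negMulLog (φ i x)) fun x =>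
        mul_nonneg (hP.nonneg a x) (Real.negMulLog_nonneg (h.nonneg i x) (h.le_one i x))
    · have hmem : p / m ∈ Icc (0 : ℝ) 1 := ⟨div_nonneg hp0 hm0.le, (div_le_one hm0).2 hpm⟩
      have havg : ∀ x ∈ A a, |p / m - φ i x| ≤ δ := by
        intro x hx
        have h1 : p ≤ (φ i x + δ) * m := by
          rw [hm, ← integral_const_mul]
          refine integral_mono hip (hig.const_mul _) fun y => ?_
          by_cases hy : y ∈ A a
          · simpa [indicatorFamily, hy] using hosc a y hy x hx i
          · simp [indicatorFamily, hy]
        have h2 : (φ i x - δ) * m ≤ p := by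
          rw [hm, ← integral_const_mul]
          refine integral_mono (hig.const_mul _) hip fun y => ?_
          by_cases hy : y ∈ A a
          · simpa [indicatorFamily, hy] using hosc a x hx y hy i
          · simp [indicatorFamily, hy]
        rw [abs_le]
        constructor
        · linarith [(le_div_iff₀ hm0).2 h2]
        · linarith [(div_le_iff₀ hm0).2 h1]
      have hle : negMulLog (p / m) * m ≤
          (∫ x, indicatorFamily A a x * negMulLog (φ i x) ∂μ) + ε * m := by
        have i1 : negMulLog (p / m) * m = ∫ x, negMulLog (p / m) * indicatorFamily A a x ∂μ :=
          (integral_const_mul _ _).symm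
        have i2 : ε * m = ∫ x, ε * indicatorFamily A a x ∂μ := (integral_const_mul _ _).symm
        rw [i1, i2, ← integral_add hin (hig.const_mul _)]
        clear_value p m
        refine integral_mono (hig.const_mul _) (hin.add (hig.const_mul _)) fun x => ?_
        by_cases hx : x ∈ A a
        · simpa [indicatorFamily, hx] using
            hδ _ hmem _ ⟨h.nonneg i x, h.le_one i x⟩ (havg x hx)
        · simp [indicatorFamily, hx]
      have hmul : negMulLog p = negMulLog (p / m) * m - p * Real.log m := by
        have := Real.negMulLog_mul m (p / m)
        rw [mul_div_cancel₀ _ hm0.ne'] at this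
        rw [this, show negMulLog m = -m * Real.log m from rfl]
        field_simp
        ring
      linarith
  have hsum := Finset.sum_le_sum fun i (_ : i ∈ Finset.univ) =>
    Finset.sum_le_sum fun a (_ : a ∈ Finset.univ) => key i a
  have e1 : ∑ i, ∑ a, ∫ x, indicatorFamily A a x * negMulLog (φ i x) ∂μ = noise μ φ := by
    refine Finset.sum_congr rfl fun i _ => ?_
    rw [← integral_finsetSum _ fun a _ => hP.integrable_mul_negMulLog h a i]
    simp_rw [← Finset.sum_mul, hP.sum_eq, one_mul]
  have e2 : ∑ i, ∑ a, (∫ x, φ i x * indicatorFamily A a x ∂μ) *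
      Real.log (∫ x, indicatorFamily A a x ∂μ) =
      - ∑ a, negMulLog (∫ x, indicatorFamily A a x ∂μ) := by
    rw [Finset.sum_comm]
    simp_rw [← Finset.sum_mul, sum_integral_mul_left h hP]
    simp [negMulLog]
  have e3 : ∑ _i : ι, ∑ a, ε * (∫ x, indicatorFamily A a x ∂μ) = Fintype.card ι * ε := by
    simp_rw [← Finset.mul_sum, hP.sum_integral]
    simp [mul_comm]
  simp only [Finset.sum_sub_distrib, Finset.sum_add_distrib] at hsum
  rw [e1, e2, e3] at hsum
  rw [staticEntropy_join_eq h hP, staticEntropy_eq μ (indicatorFamily A), noise_indicatorFamily]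
  linarith

/-- Every measurable partition of unity is approximated by finite measurable partitions. -/
theorem IsMeasurablePOU.exists_partition_staticEntropy_join_le [IsProbabilityMeasure μ]
    (h : IsMeasurablePOU φ) {ε : ℝ} (hε : 0 < ε) :
    ∃ (k : ℕ) (A : Fin k → Set X), IsMeasurablePartition A ∧
      staticEntropy μ (EntropyPOU.join φ (indicatorFamily A)) ≤
        staticEntropy μ (indicatorFamily A) + ε := by
  have huc := (isCompact_Icc (a := (0 : ℝ)) (b := 1)).uniformContinuousOn_of_continuous
    Real.continuous_negMulLog.continuousOn
  have hc : (0 : ℝ) < Fintype.card ι + 1 := by positivity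
  obtain ⟨δ, hδ, hη⟩ := Metric.uniformContinuousOn_iff_le.1 huc _ (div_pos hε hc)
  obtain ⟨k, A, hA, hosc⟩ := h.exists_partition hδ
  refine ⟨k, A, hA, (staticEntropy_join_indicator_le h hA hosc fun s hs t ht hst => ?_).trans
    (add_le_add_right (b := (Fintype.card ι : ℝ) * (ε / (Fintype.card ι + 1))) ?_ _)⟩
  · have := (abs_le.1 (hη s hs t ht hst)).2
    linarith
  · rw [mul_div_assoc', div_le_iff₀ hc]
    nlinarith

end

/-! ### Fine partitions of unity. -/

/-- Any two points of the support of a member of the family are `δ`-close. -/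
def IsFine {X ι : Type*} [MetricSpace X] (δ : ℝ) (φ : ι → X → ℝ) : Prop :=
  ∀ i x y, φ i x ≠ 0 → φ i y ≠ 0 → dist x y < δ

theorem isFine_of_familyDiam_lt {X ι : Type*} [MetricSpace X] [CompactSpace X] [Finite ι]
    {φ : ι → X → ℝ} {δ : ℝ} (h : familyDiam φ < δ) : IsFine δ φ := by
  intro i x y hx hy
  refine lt_of_le_of_lt ?_ h
  -- Boundedness matters: `Metric.diam` takes the value 0 on unbounded sets.
  have h1 := Metric.dist_le_diam_of_mem (isClosed_tsupport (φ i)).isCompact.isBounded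
    (subset_tsupport (φ i) hx) (subset_tsupport (φ i) hy)
  exact h1.trans (le_ciSup (f := fun i => Metric.diam (tsupport (φ i)))
    (Set.finite_range _).bddAbove i)

section Metric

variable {X : Type*} [MetricSpace X] [CompactSpace X] [MeasurableSpace X] [BorelSpace X]
  {κ : Type*} [Fintype κ] {μ : Measure X} {A : κ → Set X}

/-- Inner regularity gives disjoint compact sets K_a ⊆ A_a of almost full measure. A function of
small support meets at most one K_a, and this a is the guess; errors then occur only on the sets A_a
\ K_a. -/
theorem IsMeasurablePartition.exists_isFine_concentrated [DecidableEq κ] [IsProbabilityMeasure μ]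
    (hA : IsMeasurablePartition A) {e : ℝ} (he : 0 < e) :
    ∃ δ > 0, ∀ (k : ℕ) (φ : Fin k → X → ℝ), IsMeasurablePOU φ → IsFine δ φ →
      ∃ f : Fin k → κ, ∑ i, ∑ a ∈ Finset.univ.erase (f i),
        ∫ x, indicatorFamily A a x * φ i x ∂μ ≤ e := by
  obtain ⟨x₀⟩ : Nonempty X := nonempty_of_isProbabilityMeasure μ
  obtain ⟨a₀, -⟩ := mem_iUnion.1 (hA.iUnion_eq.ge (mem_univ x₀))
  set c : ℝ := e / (Fintype.card κ + 1)
  have hK : (0 : ℝ) < Fintype.card κ + 1 := by positivity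
  have hc : 0 < c := div_pos he hK
  have hex : ∀ a, ∃ K ⊆ A a, IsCompact K ∧ μ (A a \ K) < ENNReal.ofReal c := fun a =>
    (hA.measurableSet a).exists_isCompact_sdiff_lt (measure_ne_top μ _)
      (ENNReal.ofReal_pos.2 hc).ne'
  choose K hKA hKc hKμ using hex
  -- A set inside the a-th member of this cover can meet only K_a; δ is a Lebesgue number of the
  -- cover.
  have hopen : ∀ a, IsOpen (⋂ b ∈ {b | b ≠ a}, (K b)ᶜ) := fun a =>
    (Set.toFinite _).isOpen_biInter fun b _ => (hKc b).isClosed.isOpen_compl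
  have hcover : (univ : Set X) ⊆ ⋃ a, ⋂ b ∈ {b | b ≠ a}, (K b)ᶜ := by
    intro x _
    obtain ⟨a, ha⟩ := mem_iUnion.1 (hA.iUnion_eq.ge (mem_univ x))
    refine mem_iUnion.2 ⟨a, mem_iInter₂.2 fun b hb hx => ?_⟩
    exact disjoint_left.1 (hA.disjoint hb) (hKA b hx) ha
  obtain ⟨δ, hδ, hL⟩ := lebesgue_number_lemma_of_metric isCompact_univ hopen hcover
  refine ⟨δ, hδ, fun k φ hφ hfine => ?_⟩
  have hf : ∀ i, ∃ a, ∀ b ≠ a, ∀ x ∈ K b, φ i x = 0 := by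
    intro i
    by_cases hne : ∃ x, φ i x ≠ 0
    · obtain ⟨x, hx⟩ := hne
      obtain ⟨a, ha⟩ := hL x (mem_univ x)
      refine ⟨a, fun b hb y hy => ?_⟩
      by_contra hy0
      have := ha (Metric.mem_ball.2 (hfine i y x hy0 hx))
      exact mem_iInter₂.1 this b hb hy
    · push Not at hne
      exact ⟨a₀, fun b _ x _ => hne x⟩
  choose f hf using hf
  refine ⟨f, ?_⟩
  have hmeas : ∀ a, MeasurableSet (A a \ K a) := fun a =>
    (hA.measurableSet a).diff (hKc a).measurableSet
  have hint : ∀ a i, Integrable (fun x => (A a \ K a).indicator 1 x * φ i x) μ := fun a i =>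
    integrable_of_mem_unitInterval
      ((measurable_one.indicator (hmeas a)).mul (hφ.measurable i))
      (fun x => mul_nonneg (Set.indicator_nonneg (fun _ _ => zero_le_one) x) (hφ.nonneg i x))
      (fun x => mul_le_one₀ (Set.indicator_le_self' (fun _ _ => zero_le_one) x)
        (hφ.nonneg i x) (hφ.le_one i x))
  have h1 : ∀ i, ∀ a ∈ Finset.univ.erase (f i), ∫ x, indicatorFamily A a x * φ i x ∂μ =
      ∫ x, (A a \ K a).indicator 1 x * φ i x ∂μ := by
    intro i a ha
    congr 1 with x
    by_cases hx : x ∈ K a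
    · simp [hf i a (Finset.ne_of_mem_erase ha) x hx]
    · by_cases hxA : x ∈ A a <;> simp [indicatorFamily, hx, hxA]
  calc ∑ i, ∑ a ∈ Finset.univ.erase (f i), ∫ x, indicatorFamily A a x * φ i x ∂μ
      ≤ ∑ i, ∑ a, ∫ x, (A a \ K a).indicator 1 x * φ i x ∂μ := by
        refine Finset.sum_le_sum fun i _ => ?_
        rw [Finset.sum_congr rfl (h1 i)]
        refine Finset.sum_le_sum_of_subset_of_nonneg (Finset.erase_subset _ _) fun a _ _ =>
          integral_nonneg fun x =>
            mul_nonneg (Set.indicator_nonneg (fun _ _ => zero_le_one) x) (hφ.nonneg i x)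
    _ = ∑ a, μ.real (A a \ K a) := by
        rw [Finset.sum_comm]
        refine Finset.sum_congr rfl fun a _ => ?_
        rw [← integral_finsetSum _ fun i _ => hint a i, ← integral_indicator_one (hmeas a)]
        simp_rw [← Finset.mul_sum, hφ.sum_eq, mul_one]
    _ ≤ ∑ _a : κ, c := Finset.sum_le_sum fun a _ =>
        ENNReal.toReal_le_of_le_ofReal hc.le (hKμ a).le
    _ ≤ e := by
        rw [Finset.sum_const, nsmul_eq_mul, Finset.card_univ, mul_div_assoc', div_le_iff₀ hK]
        nlinarith

/-- Every finite measurable partition is approximated by all sufficiently fine partitions of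
unity. -/
theorem IsMeasurablePartition.exists_isFine_staticEntropy_join_le [IsProbabilityMeasure μ]
    (hA : IsMeasurablePartition A) {ε : ℝ} (hε : 0 < ε) :
    ∃ δ > 0, ∀ (k : ℕ) (φ : Fin k → X → ℝ), IsMeasurablePOU φ → IsFine δ φ →
      staticEntropy μ (join (indicatorFamily A) φ) ≤ staticEntropy μ φ + ε := by
  classical
  have hK : (0 : ℝ) < Fintype.card κ + 1 := by positivity
  -- c is fixed first, making the card · c term at most ε/2; the error is then taken to be (ε/2)/(1
  -- - log c), so that the other term equals ε/2.
  set c : ℝ := min 1 (ε / 2 / (Fintype.card κ + 1))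
  have hc : 0 < c := lt_min one_pos (by positivity)
  have hc1 : c ≤ 1 := min_le_left _ _
  have hlog : 0 < 1 - Real.log c := by linarith [Real.log_nonpos hc.le hc1]
  obtain ⟨δ, hδ, h⟩ := hA.exists_isFine_concentrated (μ := μ)
    (div_pos (half_pos hε) hlog)
  refine ⟨δ, hδ, fun k φ hφ hfine => ?_⟩
  obtain ⟨f, hf⟩ := h k φ hφ hfine
  have hP := hA.isMeasurablePOU
  have e1 := sum_integral_mul_left (μ := μ) hP hφ
  have key := shannon_le_of_concentrated (fun a i => ∫ x, indicatorFamily A a x * φ i x ∂μ)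
    (fun a i => integral_nonneg ((hP.join hφ).nonneg (a, i)))
    (by simp_rw [e1]; exact hφ.sum_integral) f hc hc1 hf
  simp_rw [e1] at key
  have h2 : (Fintype.card κ : ℝ) * c ≤ ε / 2 := by
    have := mul_le_mul_of_nonneg_left (min_le_right 1 (ε / 2 / (Fintype.card κ + 1))) hK.le
    rw [mul_div_cancel₀ _ hK.ne'] at this
    linarith
  rw [mul_div_cancel₀ _ hlog.ne'] at key
  rw [staticEntropy_join_eq hP hφ, noise_indicatorFamily, staticEntropy_eq μ φ]
  linarith

theorem exists_partitionOfUnity_isFine {X : Type*} [MetricSpace X] [CompactSpace X]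
    {δ : ℝ} (hδ : 0 < δ) :
    ∃ (k : ℕ) (Φ : PartitionOfUnity (Fin k) X univ), IsFine δ (fun i => ⇑(Φ i)) := by
  obtain ⟨t, -, ht, hcov⟩ := finite_cover_balls_of_compact (isCompact_univ (X := X)) (half_pos hδ)
  obtain ⟨k, ⟨e⟩⟩ := ht.exists_equiv_fin
  obtain ⟨Φ, hΦ⟩ := PartitionOfUnity.exists_isSubordinate isClosed_univ
    (fun i : Fin k => Metric.ball (e.symm i : X) (δ / 2)) (fun _ => Metric.isOpen_ball)
    (fun x hx => by
      obtain ⟨y, hy, hxy⟩ := mem_iUnion₂.1 (hcov hx)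
      exact mem_iUnion.2 ⟨e ⟨y, hy⟩, by simpa using hxy⟩)
  refine ⟨k, Φ, fun i x y hx hy => ?_⟩
  have h1 := Metric.mem_ball.1 (hΦ i (subset_tsupport (Φ i) hx))
  have h2 := Metric.mem_ball'.1 (hΦ i (subset_tsupport (Φ i) hy))
  linarith [dist_triangle x (e.symm i : X) y]

end Metric

/-! ### Topological entropy. -/

section

variable {X : Type*} [MeasurableSpace X] {ι : Type*} [Fintype ι] {φ : ι → X → ℝ} {T : X → X}

theorem IsMeasurablePOU.le_iSup (h : IsMeasurablePOU φ) (i : ι) (x : X) : φ i x ≤ ⨆ x, φ i x :=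
  le_ciSup (f := φ i) ⟨1, by rintro _ ⟨y, rfl⟩; exact h.le_one i y⟩ x

theorem IsMeasurablePOU.iSup_nonneg (h : IsMeasurablePOU φ) (i : ι) : 0 ≤ ⨆ x, φ i x :=
  Real.iSup_nonneg (h.nonneg i)

theorem IsMeasurablePOU.one_le_topStaticEntropy [Nonempty X] (h : IsMeasurablePOU φ) :
    1 ≤ topStaticEntropy φ := by
  obtain ⟨x⟩ := ‹Nonempty X›
  rw [← h.sum_eq x]
  exact Finset.sum_le_sum fun i _ => h.le_iSup i x

theorem topStaticEntropy_iterJoin_add_le [Nonempty X] (hT : Measurable T)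
    (h : IsMeasurablePOU φ) (m n : ℕ) :
    topStaticEntropy (iterJoin T φ (m + n)) ≤
      topStaticEntropy (iterJoin T φ m) * topStaticEntropy (iterJoin T φ n) := by
  have hm := h.iterJoin hT m
  have hn := h.iterJoin hT n
  simp only [topStaticEntropy]
  rw [← Equiv.sum_comp (Fin.appendEquiv m n), Fintype.sum_prod_type, Finset.sum_mul_sum]
  refine Finset.sum_le_sum fun a _ => Finset.sum_le_sum fun b _ => ciSup_le fun x => ?_
  have := congrFun (congrFun (iterJoin_append T φ m n) (a, b)) x
  simp only [join] at this
  rw [this]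
  exact mul_le_mul (hm.le_iSup a x) (hn.le_iSup b _) (hn.nonneg b _) (hm.iSup_nonneg a)

theorem exists_tendsto_topStaticEntropy [Nonempty X] (hT : Measurable T)
    (h : IsMeasurablePOU φ) :
    ∃ a : ℝ, Tendsto (fun n : ℕ => Real.log (topStaticEntropy (iterJoin T φ n)) / n)
      atTop (𝓝 a) ∧ localTopEntropy T φ = a := by
  have h1 : ∀ n, 1 ≤ topStaticEntropy (iterJoin T φ n) := fun n =>
    (h.iterJoin hT n).one_le_topStaticEntropy
  have hsub : Subadditive fun n => Real.log (topStaticEntropy (iterJoin T φ n)) := by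
    intro m n
    have hm := one_pos.trans_le (h1 m)
    have hn := one_pos.trans_le (h1 n)
    simp only
    rw [← Real.log_mul hm.ne' hn.ne']
    exact Real.log_le_log (one_pos.trans_le (h1 _)) (topStaticEntropy_iterJoin_add_le hT h m n)
  have ht := hsub.tendsto_lim ⟨0, by
    rintro _ ⟨n, rfl⟩
    exact div_nonneg (Real.log_nonneg (h1 n)) n.cast_nonneg⟩
  exact ⟨_, ht, limsup_eq_of_tendsto_coe ht⟩

end

theorem EReal_le_of_forall_pos_le_add {a b : EReal}
    (h : ∀ ε : ℝ, 0 < ε → a ≤ b + (ε : EReal)) : a ≤ b := by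
  refine EReal.le_of_forall_lt_iff_le.1 fun z hz => ?_
  induction b with
  | bot => simpa using (h 1 one_pos).trans (by simp)
  | top => simp at hz
  | coe r =>
    have hr : 0 < z - r := sub_pos.2 (EReal.coe_lt_coe_iff.1 hz)
    have := h _ hr
    rwa [← EReal.coe_add, add_sub_cancel] at this

theorem minSubcover_le {X : Type*} {α : Set (Set X)} {s : Finset (Set X)}
    (hs : (s : Set (Set X)) ⊆ α) (hs' : ⋃₀ (s : Set (Set X)) = univ) :
    minSubcover α ≤ s.card :=
  Nat.sInf_le ⟨s, hs, hs', rfl⟩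

/-- Compactness makes the set of cardinalities nonempty, so the infimum is attained and is not the
default value of `sInf ∅`. -/
theorem exists_card_eq_minSubcover {X : Type*} [TopologicalSpace X] [CompactSpace X]
    {α : Set (Set X)} (hα : IsOpenCover α) :
    ∃ s : Finset (Set X), (s : Set (Set X)) ⊆ α ∧ ⋃₀ (s : Set (Set X)) = univ ∧
      s.card = minSubcover α := by
  refine Nat.sInf_mem (s := {m | ∃ s : Finset (Set X), (s : Set (Set X)) ⊆ α ∧
    ⋃₀ (s : Set (Set X)) = univ ∧ s.card = m}) ?_
  obtain ⟨t, ht⟩ := isCompact_univ.elim_finite_subcover (fun U : α => (U : Set X))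
    (fun U => hα.isOpen U U.2) (by rw [← sUnion_eq_iUnion, hα.sUnion_eq])
  refine ⟨_, t.map (Function.Embedding.subtype _), ?_, ?_, rfl⟩
  · intro U hU
    obtain ⟨V, -, rfl⟩ := Finset.mem_map.1 hU
    exact V.2
  · refine eq_univ_of_forall fun x => ?_
    obtain ⟨U, hU, hx⟩ := mem_iUnion₂.1 (ht (mem_univ x))
    exact mem_sUnion.2 ⟨U, Finset.mem_map.2 ⟨U, hU, rfl⟩, hx⟩

theorem IsOpenCover.iterJoinCover {X : Type*} [TopologicalSpace X] {T : X → X}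
    (hT : Continuous T) {α : Set (Set X)} (hα : IsOpenCover α) (n : ℕ) :
    IsOpenCover (iterJoinCover T α n) where
  isOpen := by
    rintro _ ⟨U, hU, rfl⟩
    exact isOpen_iInter_of_finite fun j => (hα.isOpen _ (hU j)).preimage (hT.iterate _)
  sUnion_eq := by
    refine eq_univ_of_forall fun x => ?_
    have hex : ∀ j : Fin n, ∃ U ∈ α, T^[(j : ℕ)] x ∈ U := fun j =>
      mem_sUnion.1 (hα.sUnion_eq.ge (mem_univ _))
    choose U hU hx using hex
    exact mem_sUnion.2 ⟨_, ⟨U, hU, rfl⟩, mem_iInter.2 hx⟩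

section

variable {X : Type*} [MeasurableSpace X] {ι : Type*} [Fintype ι] {φ : ι → X → ℝ} {T : X → X}

/-- A cover on whose members the functions vary little controls the topological static entropy. -/
theorem topStaticEntropy_iterJoin_le_card_mul [Nonempty X]
    (h : IsMeasurablePOU φ) {α : Set (Set X)} {ε : ℝ} (hε : 0 ≤ ε)
    (hα : ∀ U ∈ α, ∀ x ∈ U, ∀ y ∈ U, ∀ i, φ i x ≤ φ i y + ε) (n : ℕ) {s : Finset (Set X)}
    (hs : (s : Set (Set X)) ⊆ iterJoinCover T α n) (hs' : ⋃₀ (s : Set (Set X)) = univ) :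
    topStaticEntropy (iterJoin T φ n) ≤ s.card * (1 + Fintype.card ι * ε) ^ n := by
  classical
  -- The bounds are the values at one point of U plus ε. Their products over times, summed over all
  -- words, factor into the n-th power.
  have hbound : ∀ U ∈ α, ∃ c : ι → ℝ, (∀ i, 0 ≤ c i) ∧ (∀ i, ∀ x ∈ U, φ i x ≤ c i) ∧
      ∑ i, c i = 1 + Fintype.card ι * ε := by
    intro U hU
    obtain ⟨y, hy⟩ : ∃ y, ∀ i, ∀ x ∈ U, φ i x ≤ φ i y + ε := by
      rcases U.eq_empty_or_nonempty with rfl | ⟨y, hy⟩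
      · exact ⟨Classical.arbitrary X, by simp⟩
      · exact ⟨y, fun i x hx => hα U hU x hx y hy i⟩
    refine ⟨fun i => φ i y + ε, fun i => add_nonneg (h.nonneg i y) hε, hy, ?_⟩
    simp [Finset.sum_add_distrib, h.sum_eq]
  have hword : ∀ V ∈ iterJoinCover T α n, ∃ C : (Fin n → ι) → ℝ, (∀ a, 0 ≤ C a) ∧
      (∀ a, ∀ x ∈ V, iterJoin T φ n a x ≤ C a) ∧
      ∑ a, C a = (1 + Fintype.card ι * ε) ^ n := by
    rintro _ ⟨U, hU, rfl⟩
    choose c hc0 hc hcs using fun j => hbound (U j) (hU j)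
    refine ⟨fun a => ∏ j, c j (a j), fun a => Finset.prod_nonneg fun j _ => hc0 j _,
      fun a x hx => Finset.prod_le_prod (fun j _ => h.nonneg _ _) fun j _ =>
        hc j _ _ (mem_iInter.1 hx j), ?_⟩
    have := Finset.prod_univ_sum (fun _ : Fin n => (Finset.univ : Finset ι)) c
    rw [Fintype.piFinset_univ] at this
    rw [← this]
    simp [hcs]
  choose! C hC0 hC hCs using hword
  calc topStaticEntropy (iterJoin T φ n) ≤ ∑ a, ∑ V ∈ s, C V a := by
        refine Finset.sum_le_sum fun a _ => ciSup_le fun x => ?_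
        obtain ⟨V, hV, hx⟩ := mem_sUnion.1 (hs'.ge (mem_univ x))
        exact (hC V (hs hV) a x hx).trans
          (Finset.single_le_sum (f := fun V => C V a) (fun V hV => hC0 V (hs hV) a) hV)
    _ = s.card * (1 + Fintype.card ι * ε) ^ n := by
        rw [Finset.sum_comm, Finset.sum_congr rfl fun V hV => hCs V (hs hV), Finset.sum_const,
          nsmul_eq_mul]

end

/-- A sufficiently fine partition of unity has at least the entropy of a given open cover. -/
theorem minSubcover_iterJoinCover_le {X : Type*} [MetricSpace X] [MeasurableSpace X]
    {ι : Type*} [Fintype ι] {φ : ι → X → ℝ} {T : X → X} (hT : Measurable T) (h : IsMeasurablePOU φ)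
    {α : Set (Set X)} {δ : ℝ} (hfine : IsFine δ φ)
    (hα : ∀ x, ∃ U ∈ α, Metric.ball x δ ⊆ U) (n : ℕ) :
    (minSubcover (iterJoinCover T α n) : ℝ) ≤ topStaticEntropy (iterJoin T φ n) := by
  classical
  have hn := h.iterJoin hT n
  -- These play the role of separated sets. The word functions sum to 1 at each point and each is
  -- nonzero at one point of E at most, so the cardinality of E is at most the sum of the suprema.
  set S : Set (Finset X) := {E | ∀ x ∈ E, ∀ y ∈ E, ∀ w,
    iterJoin T φ n w x ≠ 0 → iterJoin T φ n w y ≠ 0 → x = y}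
  have hcard : ∀ E ∈ S, (E.card : ℝ) ≤ topStaticEntropy (iterJoin T φ n) := by
    intro E hE
    calc (E.card : ℝ) = ∑ w, ∑ x ∈ E, iterJoin T φ n w x := by
          rw [Finset.sum_comm]; simp [hn.sum_eq]
      _ ≤ topStaticEntropy (iterJoin T φ n) := Finset.sum_le_sum fun w _ => by
          by_cases hex : ∃ x ∈ E, iterJoin T φ n w x ≠ 0
          · obtain ⟨x, hx, hx0⟩ := hex
            rw [Finset.sum_eq_single_of_mem x hx fun y hy hyx => by
              by_contra hy0
              exact hyx (hE y hy x hx w hy0 hx0)]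
            exact hn.le_iSup w x
          · push Not at hex
            rw [Finset.sum_eq_zero hex]
            exact hn.iSup_nonneg w
  obtain ⟨E, hES, hEmax⟩ : ∃ E ∈ S, ∀ F ∈ S, F.card ≤ E.card := by
    have hne : (Finset.card '' S).Nonempty := ⟨_, ∅, by simp [S], rfl⟩
    have hbdd : BddAbove (Finset.card '' S) := ⟨⌊topStaticEntropy (iterJoin T φ n)⌋₊, by
      rintro _ ⟨E, hE, rfl⟩
      exact Nat.le_floor (hcard E hE)⟩
    obtain ⟨E, hE, hEc⟩ := Nat.sSup_mem hne hbdd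
    exact ⟨E, hE, fun F hF => hEc ▸ le_csSup hbdd ⟨F, hF, rfl⟩⟩
  -- By maximality of E; fineness then keeps the orbits of x and y δ-close up to time n - 1.
  have hlink : ∀ y, ∃ x ∈ E, ∃ w, iterJoin T φ n w x ≠ 0 ∧ iterJoin T φ n w y ≠ 0 := by
    intro y
    by_contra! hno
    have hyE : y ∉ E := fun hy => by
      have : ∑ w, iterJoin T φ n w y = 0 := Finset.sum_eq_zero fun w _ => by
        by_contra h0
        exact h0 (hno y hy w h0)
      rw [hn.sum_eq] at this
      exact one_ne_zero this
    have : insert y E ∈ S := by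
      intro x hx z hz w hxw hzw
      rcases Finset.mem_insert.1 hx with hxy | hxE <;>
        rcases Finset.mem_insert.1 hz with hzy | hzE
      · exact hxy.trans hzy.symm
      · exact absurd (hno z hzE w hzw) (hxy ▸ hxw)
      · exact absurd (hno x hxE w hxw) (hzy ▸ hzw)
      · exact hES x hxE z hzE w hxw hzw
    have := hEmax _ this
    rw [Finset.card_insert_of_notMem hyE] at this
    omega
  choose U hUα hU using hα
  refine le_trans ?_ (hcard E hES)
  have hle := minSubcover_le (α := iterJoinCover T α n)
    (s := E.image fun x => ⋂ j : Fin n, T^[(j : ℕ)] ⁻¹' U (T^[(j : ℕ)] x)) ?_ ?_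
  · exact_mod_cast hle.trans Finset.card_image_le
  · intro V hV
    obtain ⟨x, -, rfl⟩ := Finset.mem_image.1 (Finset.mem_coe.1 hV)
    exact ⟨fun j => U (T^[(j : ℕ)] x), fun j => hUα _, rfl⟩
  · refine eq_univ_of_forall fun y => ?_
    obtain ⟨x, hx, w, hxw, hyw⟩ := hlink y
    refine mem_sUnion.2 ⟨_, Finset.mem_coe.2 (Finset.mem_image_of_mem _ hx),
      mem_iInter.2 fun j => hU _ (Metric.mem_ball.2 ?_)⟩
    exact hfine (w j) _ _ (Finset.prod_ne_zero_iff.1 hyw j (Finset.mem_univ j))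
      (Finset.prod_ne_zero_iff.1 hxw j (Finset.mem_univ j))

theorem coverTopEntropy_le_localTopEntropy {X : Type*} [MetricSpace X] [Nonempty X]
    [MeasurableSpace X] {ι : Type*} [Fintype ι] {φ : ι → X → ℝ} {T : X → X}
    (hT : Measurable T) (h : IsMeasurablePOU φ)
    {α : Set (Set X)} {δ : ℝ} (hfine : IsFine δ φ)
    (hα : ∀ x, ∃ U ∈ α, Metric.ball x δ ⊆ U) : coverTopEntropy T α ≤ localTopEntropy T φ := by
  refine limsup_le_limsup (Eventually.of_forall fun n => ?_)
  rw [EReal.coe_le_coe_iff]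
  refine div_le_div_of_nonneg_right ?_ n.cast_nonneg
  have h1 := (h.iterJoin hT n).one_le_topStaticEntropy
  rcases Nat.eq_zero_or_pos (minSubcover (iterJoinCover T α n)) with h0 | h0
  · rw [h0, Nat.cast_zero, Real.log_zero]
    exact Real.log_nonneg h1
  · exact Real.log_le_log (Nat.cast_pos.2 h0) (minSubcover_iterJoinCover_le hT h hfine hα n)

section

variable {X : Type*} [MetricSpace X] [CompactSpace X] [Nonempty X] [MeasurableSpace X]
  [BorelSpace X] {ι : Type*} [Fintype ι] {φ : ι → X → ℝ} {T : X → X}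

theorem localTopEntropy_le_topEntropy (hT : Continuous T) (h : IsMeasurablePOU φ)
    (hφ : ∀ i, Continuous (φ i)) : localTopEntropy T φ ≤ topEntropy T := by
  refine EReal_le_of_forall_pos_le_add fun ε hε => ?_
  have hK : (0 : ℝ) < Fintype.card ι + 1 := by positivity
  set η : ℝ := ε / (Fintype.card ι + 1)
  have hη : 0 < η := div_pos hε hK
  have hKη : Fintype.card ι * η ≤ ε := by
    rw [mul_div_assoc', div_le_iff₀ hK]
    nlinarith
  have hKη0 : 0 ≤ Fintype.card ι * η := by positivity
  -- With this η, log (1 + card · η) ≤ ε, so the oscillation costs at most ε per unit of time.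
  set α : Set (Set X) := {U | IsOpen U ∧ ∀ x ∈ U, ∀ y ∈ U, ∀ i, φ i x ≤ φ i y + η}
  have hα : IsOpenCover α := by
    refine ⟨fun U hU => hU.1, eq_univ_of_forall fun z => mem_sUnion.2
      ⟨⋂ i, φ i ⁻¹' Metric.ball (φ i z) (η / 2), ⟨isOpen_iInter_of_finite fun i =>
        Metric.isOpen_ball.preimage (hφ i), fun x hx y hy i => ?_⟩,
        mem_iInter.2 fun i => Metric.mem_ball_self (half_pos hη)⟩⟩
    have h1 := abs_lt.1 (Metric.mem_ball.1 (mem_iInter.1 hx i))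
    have h2 := abs_lt.1 (Metric.mem_ball.1 (mem_iInter.1 hy i))
    linarith [h1.2, h2.1]
  obtain ⟨a, ha, ha'⟩ := exists_tendsto_topStaticEntropy hT.measurable h
  have hcover : ((a - ε : ℝ) : EReal) ≤ coverTopEntropy T α := by
    rw [← limsup_eq_of_tendsto_coe (ha.sub_const ε)]
    refine limsup_le_limsup ?_
    filter_upwards [eventually_gt_atTop 0] with n hn
    have hn' : (0 : ℝ) < n := Nat.cast_pos.2 hn
    rw [EReal.coe_le_coe_iff, sub_le_iff_le_add, div_add' _ _ _ hn'.ne']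
    gcongr
    obtain ⟨s, hs, hs', hcard⟩ := exists_card_eq_minSubcover (hα.iterJoinCover hT n)
    have h1 := (h.iterJoin hT.measurable n).one_le_topStaticEntropy
    have h2 := topStaticEntropy_iterJoin_le_card_mul h hη.le
      (fun U hU => hU.2) n hs hs'
    rw [hcard] at h2
    have hN : (minSubcover (iterJoinCover T α n) : ℝ) ≠ 0 := fun h0 => by
      rw [h0, zero_mul] at h2
      linarith
    have h3 := Real.log_le_log (one_pos.trans_le h1) h2
    rw [Real.log_mul hN (by positivity), Real.log_pow] at h3
    have h4 : Real.log (1 + Fintype.card ι * η) ≤ ε := by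
      have := Real.log_le_sub_one_of_pos (show 0 < 1 + Fintype.card ι * η by positivity)
      linarith
    have h5 := mul_le_mul_of_nonneg_left h4 hn'.le
    linarith
  have htop : coverTopEntropy T α ≤ topEntropy T :=
    le_iSup₂ (f := fun α _ => coverTopEntropy T α) α hα
  calc localTopEntropy T φ = ((a - ε : ℝ) : EReal) + ε := by
        rw [ha', ← EReal.coe_add, sub_add_cancel]
    _ ≤ topEntropy T + ε := add_le_add_left (hcover.trans htop) _

end

/-! ### Comparison of the entropies. -/

theorem localMetricEntropy_le_metricEntropy {X : Type*} [MeasurableSpace X] {T : X → X}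
    {μ : Measure X} [IsProbabilityMeasure μ] (hT : MeasurePreserving T μ μ)
    {ι : Type*} [Fintype ι] {φ : ι → X → ℝ} (h : IsMeasurablePOU φ) :
    localMetricEntropy T μ φ ≤ metricEntropy T μ := by
  refine EReal_le_of_forall_pos_le_add fun ε hε => ?_
  obtain ⟨k, A, hA, hle⟩ := h.exists_partition_staticEntropy_join_le (μ := μ) hε
  refine (localMetricEntropy_le_add hT h hA.isMeasurablePOU hle).trans (add_le_add_left ?_ _)
  rw [← partitionMetricEntropy_eq hT.measurable hA]
  exact le_iSup_of_le k (le_iSup₂_of_le A hA le_rfl)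

theorem localMetricEntropy_le_pouMetricEntropy {X : Type*} [TopologicalSpace X]
    [MeasurableSpace X] {T : X → X} {μ : Measure X} {k : ℕ} (Φ : PartitionOfUnity (Fin k) X univ) :
    localMetricEntropy T μ (fun i => ⇑(Φ i)) ≤ pouMetricEntropy T μ :=
  le_iSup₂ (f := fun k (Φ : PartitionOfUnity (Fin k) X univ) =>
    localMetricEntropy T μ fun i => ⇑(Φ i)) k Φ

theorem isMeasurablePOU_of_partitionOfUnity {X : Type*} [TopologicalSpace X] [MeasurableSpace X]
    [BorelSpace X] {k : ℕ} (Φ : PartitionOfUnity (Fin k) X univ) :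
    IsMeasurablePOU fun i => ⇑(Φ i) where
  measurable i := (Φ i).continuous.measurable
  nonneg i x := Φ.nonneg i x
  sum_eq x := by rw [← finsum_eq_sum_of_fintype]; exact Φ.sum_eq_one (mem_univ x)

section

variable {X : Type*} [MetricSpace X] [CompactSpace X] [MeasurableSpace X] [BorelSpace X]
  {T : X → X}

theorem pouTopEntropy_eq_topEntropy [Nonempty X] (hT : Continuous T) :
    pouTopEntropy T = topEntropy T := by
  refine le_antisymm (iSup₂_le fun k Φ => localTopEntropy_le_topEntropy hT
    (isMeasurablePOU_of_partitionOfUnity Φ) fun i => (Φ i).continuous) (iSup₂_le fun α hα => ?_)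
  obtain ⟨δ, hδ, hL⟩ := lebesgue_number_lemma_of_metric_sUnion (isCompact_univ (X := X))
    hα.isOpen hα.sUnion_eq.ge
  obtain ⟨k, Φ, hΦ⟩ := exists_partitionOfUnity_isFine (X := X) hδ
  exact (coverTopEntropy_le_localTopEntropy hT.measurable (isMeasurablePOU_of_partitionOfUnity Φ)
    hΦ fun x => hL x (mem_univ x)).trans
    (le_iSup₂ (f := fun k (Φ : PartitionOfUnity (Fin k) X univ) =>
      localTopEntropy T fun i => ⇑(Φ i)) k Φ)

variable {μ : Measure X} [IsProbabilityMeasure μ]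

/-- δ is uniform over all fine families, whatever their number of members; this serves both the
equality of the suprema and the limit along vanishing diameters. -/
theorem IsMeasurablePartition.exists_isFine_partitionMetricEntropy_le
    (hT : MeasurePreserving T μ μ) {l : ℕ} {A : Fin l → Set X} (hA : IsMeasurablePartition A)
    {ε : ℝ} (hε : 0 < ε) :
    ∃ δ > 0, ∀ (k : ℕ) (φ : Fin k → X → ℝ), IsMeasurablePOU φ → IsFine δ φ →
      partitionMetricEntropy T μ A ≤ localMetricEntropy T μ φ + (ε : EReal) := by
  obtain ⟨δ, hδ, h⟩ := hA.exists_isFine_staticEntropy_join_le (μ := μ) hε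
  refine ⟨δ, hδ, fun k φ hφ hfine => ?_⟩
  rw [partitionMetricEntropy_eq hT.measurable hA]
  exact localMetricEntropy_le_add hT hA.isMeasurablePOU hφ (h k φ hφ hfine)

theorem pouMetricEntropy_eq_metricEntropy (hT : MeasurePreserving T μ μ) :
    pouMetricEntropy T μ = metricEntropy T μ := by
  refine le_antisymm (iSup₂_le fun k Φ => localMetricEntropy_le_metricEntropy hT
    (isMeasurablePOU_of_partitionOfUnity Φ)) (iSup_le fun l => iSup₂_le fun A hA => ?_)
  refine EReal_le_of_forall_pos_le_add fun ε hε => ?_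
  obtain ⟨δ, hδ, h⟩ := hA.exists_isFine_partitionMetricEntropy_le hT hε
  obtain ⟨k, Φ, hΦ⟩ := exists_partitionOfUnity_isFine (X := X) hδ
  exact (h k _ (isMeasurablePOU_of_partitionOfUnity Φ) hΦ).trans
    (add_le_add_left (localMetricEntropy_le_pouMetricEntropy Φ) _)

theorem tendsto_localMetricEntropy_of_familyDiam (hT : MeasurePreserving T μ μ) (k : ℕ → ℕ)
    (Φ : ∀ m : ℕ, PartitionOfUnity (Fin (k m)) X univ)
    (hΦ : Tendsto (fun m => familyDiam (fun i => ⇑(Φ m i))) atTop (𝓝 0)) :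
    Tendsto (fun m => localMetricEntropy T μ (fun i => ⇑(Φ m i))) atTop
      (𝓝 (pouMetricEntropy T μ)) := by
  refine tendsto_order.2 ⟨fun b hb => ?_, fun b hb => Eventually.of_forall fun m =>
    (localMetricEntropy_le_pouMetricEntropy (Φ m)).trans_lt hb⟩
  obtain ⟨r, hbr, hr⟩ := EReal.lt_iff_exists_real_btwn.1 hb
  rw [pouMetricEntropy_eq_metricEntropy hT, metricEntropy] at hr
  obtain ⟨l, hr⟩ := lt_iSup_iff.1 hr
  obtain ⟨A, hr⟩ := lt_iSup_iff.1 hr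
  obtain ⟨hA, hr⟩ := lt_iSup_iff.1 hr
  -- The supremum may be infinite, so the argument uses real numbers below it; the gap r' - r is the
  -- loss allowed in the approximation.
  obtain ⟨r', hrr', hr'⟩ := EReal.lt_iff_exists_real_btwn.1 hr
  obtain ⟨δ, hδ, h⟩ := hA.exists_isFine_partitionMetricEntropy_le hT
    (sub_pos.2 (EReal.coe_lt_coe_iff.1 hrr'))
  filter_upwards [hΦ.eventually_lt_const hδ] with m hm
  have hP := isMeasurablePOU_of_partitionOfUnity (Φ m)
  have h1 := hr'.trans_le (h _ _ hP (isFine_of_familyDiam_lt hm))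
  obtain ⟨a, -, ha⟩ := exists_tendsto_staticEntropy hT hP
  rw [ha, ← EReal.coe_add, EReal.coe_lt_coe_iff] at h1
  rw [ha]
  exact hbr.trans (EReal.coe_lt_coe_iff.2 (by linarith))

end

end EntropyPOU

end

theorem theorem1 {X : Type*} [MetricSpace X] [CompactSpace X] [Nonempty X]
    [MeasurableSpace X] [BorelSpace X] (T : X → X) (hT : Continuous T)
    (hT_surj : Function.Surjective T) :
    -- the limits defining the local entropies exist
    (∀ (k : ℕ) (Φ : PartitionOfUnity (Fin k) X univ),
      (∀ (μ : Measure X) [IsProbabilityMeasure μ], MeasurePreserving T μ μ →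
        Tendsto (fun n : ℕ => ((EntropyPOU.staticEntropy μ
            (EntropyPOU.iterJoin T (fun i => ⇑(Φ i)) n) / n : ℝ) : EReal)) atTop
          (𝓝 (EntropyPOU.localMetricEntropy T μ (fun i => ⇑(Φ i))))) ∧
      Tendsto (fun n : ℕ => ((Real.log (EntropyPOU.topStaticEntropy
          (EntropyPOU.iterJoin T (fun i => ⇑(Φ i)) n)) / n : ℝ) : EReal)) atTop
        (𝓝 (EntropyPOU.localTopEntropy T (fun i => ⇑(Φ i))))) ∧
    -- metric entropies agree
    (∀ (μ : Measure X) [IsProbabilityMeasure μ], MeasurePreserving T μ μ →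
      EntropyPOU.pouMetricEntropy T μ = EntropyPOU.metricEntropy T μ) ∧
    -- topological entropies agree
    EntropyPOU.pouTopEntropy T = EntropyPOU.topEntropy T ∧
    -- sequences with vanishing diameters are maximizing
    (∀ (k : ℕ → ℕ) (Φ : ∀ m : ℕ, PartitionOfUnity (Fin (k m)) X univ),
      Tendsto (fun m => EntropyPOU.familyDiam (fun i => ⇑(Φ m i))) atTop (𝓝 0) →
      ∀ (μ : Measure X) [IsProbabilityMeasure μ], MeasurePreserving T μ μ →
        Tendsto (fun m => EntropyPOU.localMetricEntropy T μ (fun i => ⇑(Φ m i))) atTop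
          (𝓝 (EntropyPOU.pouMetricEntropy T μ))) := by

  refine ⟨fun k Φ => ⟨fun μ _ hμ => ?_, ?_⟩,
    fun μ _ hμ => EntropyPOU.pouMetricEntropy_eq_metricEntropy hμ,
    EntropyPOU.pouTopEntropy_eq_topEntropy hT,
    fun k Φ hΦ μ _ hμ => EntropyPOU.tendsto_localMetricEntropy_of_familyDiam hμ k Φ hΦ⟩
  · obtain ⟨a, ha, ha'⟩ := EntropyPOU.exists_tendsto_staticEntropy hμ
      (EntropyPOU.isMeasurablePOU_of_partitionOfUnity Φ)
    rw [ha']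
    exact (continuous_coe_real_ereal.tendsto a).comp ha
  · obtain ⟨a, ha, ha'⟩ := EntropyPOU.exists_tendsto_topStaticEntropy hT.measurable
      (EntropyPOU.isMeasurablePOU_of_partitionOfUnity Φ)
    rw [ha']
    exact (continuous_coe_real_ereal.tendsto a).comp ha
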